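/- Fix $b>0$ and $z\in\mathbb{C}$. Let $L_{z,b}$ be the operator on $L^2(\mathbb{R})$ formally given by $$L_{z,b}\,y=-y''+\Big(\frac{x^2}{4}-\frac12\Big)y+z\,[\delta(x-b)-\delta(x+b)]\,y,$$ that is, the operator associated with the sesquilinear form $$t_{z,b}(f,g)=\langle f',g'\rangle+\tfrac14\langle xf,xg\rangle-\tfrac12\langle f,g\rangle+z\big(f(b)\overline{g(b)}-f(-b)\overline{g(-b)}\big)$$ with domain $\mathrm{Dom}(t)=\{f\in H^1(\mathbb{R}): xf\in L^2(\mathbb{R})\}$: $f\in\mathrm{Dom}(L_{z,b})$ and $L_{z,b}f=h$ if and only if $f\in\mathrm{Dom}(t)$, $h\in L^2(\mathbb{R})$ and $t_{z,b}(f,g)=\langle h,g\rangle$ for all $g\in\mathrm{Dom}(t)$. (Here $\langle f,g\rangle=\int_{\mathbb R} f\overline{g}\,dx$, and elements of $H^1(\mathbb R)$ are identified with their continuous representatives.) For $\nu,x\in\mathbb{C}$ let $$y_{\rm even}(\nu,x)=e^{-x^2/4}\sum_{k\ge0}\Big(\prod_{j=0}^{k-1}(2j-\nu)\Big)\frac{x^{2k}}{(2k)!},\qquad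 y_{\rm odd}(\nu,x)=e^{-x^2/4}\sum_{k\ge0}\Big(\prod_{j=0}^{k-1}(2j+1-\nu)\Big)\frac{x^{2k+1}}{(2k+1)!},$$ $$D_\nu(x)=\frac{2^{\nu/2}\sqrt\pi}{\Gamma\left(\frac{1-\nu}{2}\right)}\,y_{\rm even}(\nu,x)-\frac{2^{(\nu+1)/2}\sqrt\pi}{\Gamma\left(-\frac{\nu}{2}\right)}\,y_{\rm odd}(\nu,x)$$ (the parabolic cylinder function), where $1/\Gamma$ denotes the entire reciprocal Gamma function, and for $\nu\in\mathbb{C}\setminus\mathbb{N}_0$ let $$M(\nu;b)=\sqrt{\tfrac{2}{\pi}}\;\Gamma(-\nu)\,D_\nu(b)^2\,y_{\rm even}(\nu,b)\,y_{\rm odd}(\nu,b).$$ Then: 1. For every $\nu\in\mathbb{C}$, $\nu$ belongs to the spectrum of $L_{z,b}$ if and only if $$\frac{1}{\Gamma(-\nu)}-z^2D_\nu(b)^2\,\sqrt{\tfrac{2}{\pi}}\;y_{\rm even}(\nu,b)\,y_{\rm odd}(\nu,b)=0,$$ and $\nu$ is an eigenvalue of $L_{z,b}$ if and only if the same equation holds.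 2. For every $\nu\in\mathbb{C}\setminus\mathbb{N}_0$, $\nu$ belongs to the spectrum of $L_{z,b}$ if and only if $z\neq0$ and $M(\nu;b)=1/z^2$, and $\nu$ is an eigenvalue of $L_{z,b}$ if and only if $z\ne0$ and $M(\nu;b)=1/z^2$. 3. The function $M(\cdot\,;b)$ has a non-removable pole at $\nu=0$; in particular, it is not constant on $\mathbb{C}\setminus\mathbb{N}_0$. 4. If $\nu\in\mathbb{R}\setminus\mathbb{N}_0$, then $M(\nu;b)$ is real. -/

import Mathlib

open MeasureTheory
open scoped ContDiff ComplexConjugate ENNReal Topology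

noncomputable section

namespace PointInteraction

/-! ### Unbounded operators: eigenvalues and spectrum -/

section Operators

variable {H : Type*} [NormedAddCommGroup H] [NormedSpace ℂ H]

/-- `ν` is an eigenvalue of the (unbounded) operator `T`. -/
def IsEigenvalue (T : H →ₗ.[ℂ] H) (ν : ℂ) : Prop :=
  ∃ x : T.domain, (x : H) ≠ 0 ∧ T x = ν • (x : H)

/-- The resolvent set of `T`: those `ν` for which `T - ν : dom T → H` is a bijection with bounded
(everywhere defined) inverse `R`. -/
def resolventSet (T : H →ₗ.[ℂ] H) : Set ℂ :=
  {ν | ∃ R : H →L[ℂ] H,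
    (∀ h : H, ∃ x : T.domain, (x : H) = R h ∧ T x - ν • (x : H) = h) ∧
    ∀ x : T.domain, R (T x - ν • (x : H)) = x}

/-- The spectrum of `T`. -/
def spectrum (T : H →ₗ.[ℂ] H) : Set ℂ := (resolventSet T)ᶜ

end Operators

/-! ### The form domain `{f ∈ H¹(ℝ) : x f ∈ L²(ℝ)}` -/

/-- `g` is a weak (distributional) derivative of `f` on `ℝ`. -/
def IsWeakDeriv (f g : ℝ → ℂ) : Prop :=
  ∀ φ : ℝ → ℝ, ContDiff ℝ ∞ φ → HasCompactSupport φ →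
    ∫ x, deriv φ x • f x = - ∫ x, φ x • g x

/-- `f` has a weak derivative in `L²(ℝ)`. -/
def HasL2WeakDeriv (f : ℝ → ℂ) : Prop :=
  ∃ g : ℝ → ℂ, MemLp g 2 volume ∧ IsWeakDeriv f g

open Classical in
/-- The weak derivative in `L²(ℝ)` (unique up to a null set); `0` if there is none. -/
def weakDeriv (f : ℝ → ℂ) : ℝ → ℂ :=
  if h : HasL2WeakDeriv f then h.choose else 0

/-- A test function against a function in `L²(ℝ)` is integrable. -/
theorem integrable_test_smul {f : ℝ → ℂ} (hf : MemLp f 2 volume) {φ : ℝ → ℝ}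
    (hφ : Continuous φ) (hc : HasCompactSupport φ) : Integrable fun x => φ x • f x :=
  (hf.locallyIntegrable (by norm_num)).integrable_smul_left_of_hasCompactSupport hφ hc

theorem IsWeakDeriv.add {f₁ f₂ g₁ g₂ : ℝ → ℂ}
    (hf₁ : MemLp f₁ 2 volume) (hf₂ : MemLp f₂ 2 volume)
    (hg₁ : MemLp g₁ 2 volume) (hg₂ : MemLp g₂ 2 volume)
    (h₁ : IsWeakDeriv f₁ g₁) (h₂ : IsWeakDeriv f₂ g₂) : IsWeakDeriv (f₁ + f₂) (g₁ + g₂) := by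
  intro φ hφ hc
  have hd : Continuous (deriv φ) := hφ.continuous_deriv (by simp)
  simp only [Pi.add_apply, smul_add]
  rw [integral_add (integrable_test_smul hf₁ hd hc.deriv) (integrable_test_smul hf₂ hd hc.deriv),
    integral_add (integrable_test_smul hg₁ hφ.continuous hc)
      (integrable_test_smul hg₂ hφ.continuous hc), h₁ φ hφ hc, h₂ φ hφ hc]
  ring

theorem IsWeakDeriv.smul {f g : ℝ → ℂ} (c : ℂ) (h : IsWeakDeriv f g) :
    IsWeakDeriv (c • f) (c • g) := by
  intro φ hφ hc
  have h' := h φ hφ hc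
  simp only [Pi.smul_apply, smul_comm _ c]
  rw [integral_smul, integral_smul, h', smul_neg]

theorem isWeakDeriv_zero : IsWeakDeriv 0 0 := by
  intro φ _ _
  simp

/-- The form domain. Elements of `H¹(ℝ)` are identified with their continuous representatives,
so that point values make sense. -/
def formDomain : Submodule ℂ (ℝ → ℂ) where
  carrier := {f | Continuous f ∧ MemLp f 2 volume ∧ HasL2WeakDeriv f ∧
    MemLp (fun x : ℝ => (x : ℂ) * f x) 2 volume}
  zero_mem' := ⟨continuous_zero, MemLp.zero, ⟨0, MemLp.zero, isWeakDeriv_zero⟩, by simp⟩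
  add_mem' := by
    rintro f g ⟨hf, hf2, ⟨f', hf', hw⟩, hfx⟩ ⟨hg, hg2, ⟨g', hg', hv⟩, hgx⟩
    refine ⟨hf.add hg, hf2.add hg2, ⟨f' + g', hf'.add hg', hw.add hf2 hg2 hf' hg' hv⟩, ?_⟩
    have := hfx.add hgx
    refine this.congr_norm ?_ ?_
    · exact ((Complex.continuous_ofReal.mul (hf.add hg))).aestronglyMeasurable
    · exact Filter.Eventually.of_forall fun x => by simp [mul_add]
  smul_mem' := by
    rintro c f ⟨hf, hf2, ⟨f', hf', hw⟩, hfx⟩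
    refine ⟨hf.const_smul c, hf2.const_smul c, ⟨c • f', hf'.const_smul c, hw.smul c⟩, ?_⟩
    have := hfx.const_smul c
    refine this.congr_norm ?_ ?_
    · exact ((Complex.continuous_ofReal.mul (hf.const_smul c))).aestronglyMeasurable
    · exact Filter.Eventually.of_forall fun x => by simp [mul_left_comm]

theorem weakDeriv_spec {f : ℝ → ℂ} (hf : HasL2WeakDeriv f) :
    MemLp (weakDeriv f) 2 volume ∧ IsWeakDeriv f (weakDeriv f) := by
  rw [weakDeriv, dif_pos hf]
  exact hf.choose_spec

theorem weakDeriv_ae_eq {f g : ℝ → ℂ} (hg : MemLp g 2 volume) (h : IsWeakDeriv f g) :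
    weakDeriv f =ᵐ[volume] g := by
  have hs := weakDeriv_spec ⟨g, hg, h⟩
  refine ae_eq_of_integral_contDiff_smul_eq (hs.1.locallyIntegrable (by norm_num))
    (hg.locallyIntegrable (by norm_num)) fun φ hφ hc => ?_
  exact neg_injective ((hs.2 φ hφ hc).symm.trans (h φ hφ hc))

/-! ### The form and the operator -/

/-- The sesquilinear form of `-y'' + (x²/4 - 1/2) y + z (δ(x - b) - δ(x + b)) y`. -/
def form (z : ℂ) (b : ℝ) (f g : ℝ → ℂ) : ℂ :=
  (∫ x, weakDeriv f x * conj (weakDeriv g x))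
    + (1 / 4) * (∫ x : ℝ, ((x : ℂ) * f x) * conj ((x : ℂ) * g x))
    - (1 / 2) * (∫ x, f x * conj (g x))
    + z * (f b * conj (g b) - f (-b) * conj (g (-b)))

theorem integrable_mul_conj {f g : ℝ → ℂ} (hf : MemLp f 2 volume) (hg : MemLp g 2 volume) :
    Integrable fun x => f x * conj (g x) :=
  hf.integrable_mul hg.star

theorem form_add_left (z : ℂ) (b : ℝ) {f₁ f₂ g : ℝ → ℂ} (h₁ : f₁ ∈ formDomain)
    (h₂ : f₂ ∈ formDomain) (hg : g ∈ formDomain) :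
    form z b (f₁ + f₂) g = form z b f₁ g + form z b f₂ g := by
  obtain ⟨-, h₁l, h₁d, h₁x⟩ := h₁
  obtain ⟨-, h₂l, h₂d, h₂x⟩ := h₂
  obtain ⟨-, hgl, hgd, hgx⟩ := hg
  have s₁ := weakDeriv_spec h₁d
  have s₂ := weakDeriv_spec h₂d
  have sg := weakDeriv_spec hgd
  have hd := weakDeriv_ae_eq (s₁.1.add s₂.1) (s₁.2.add h₁l h₂l s₁.1 s₂.1 s₂.2)
  have e₁ : ∫ x, weakDeriv (f₁ + f₂) x * conj (weakDeriv g x)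
      = (∫ x, weakDeriv f₁ x * conj (weakDeriv g x))
        + ∫ x, weakDeriv f₂ x * conj (weakDeriv g x) := by
    rw [← integral_add (integrable_mul_conj s₁.1 sg.1) (integrable_mul_conj s₂.1 sg.1)]
    refine integral_congr_ae ?_
    filter_upwards [hd] with x hx
    rw [hx, Pi.add_apply, add_mul]
  have e₂ : ∫ x : ℝ, ((x : ℂ) * (f₁ + f₂) x) * conj ((x : ℂ) * g x)
      = (∫ x : ℝ, ((x : ℂ) * f₁ x) * conj ((x : ℂ) * g x))
        + ∫ x : ℝ, ((x : ℂ) * f₂ x) * conj ((x : ℂ) * g x) := by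
    rw [← integral_add (integrable_mul_conj h₁x hgx) (integrable_mul_conj h₂x hgx)]
    refine integral_congr_ae (Filter.Eventually.of_forall fun x => ?_)
    simp only [Pi.add_apply]
    ring
  have e₃ : ∫ x, (f₁ + f₂) x * conj (g x)
      = (∫ x, f₁ x * conj (g x)) + ∫ x, f₂ x * conj (g x) := by
    rw [← integral_add (integrable_mul_conj h₁l hgl) (integrable_mul_conj h₂l hgl)]
    refine integral_congr_ae (Filter.Eventually.of_forall fun x => ?_)
    simp only [Pi.add_apply]
    ring
  unfold form
  rw [e₁, e₂, e₃]
  simp only [Pi.add_apply]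
  ring

theorem form_smul_left (z : ℂ) (b : ℝ) (c : ℂ) {f g : ℝ → ℂ} (hf : f ∈ formDomain) :
    form z b (c • f) g = c * form z b f g := by
  obtain ⟨-, -, hd, -⟩ := hf
  have s := weakDeriv_spec hd
  have hd := weakDeriv_ae_eq (s.1.const_smul c) (s.2.smul c)
  have e₁ : ∫ x, weakDeriv (c • f) x * conj (weakDeriv g x)
      = c * ∫ x, weakDeriv f x * conj (weakDeriv g x) := by
    rw [← integral_const_mul]
    refine integral_congr_ae ?_
    filter_upwards [hd] with x hx
    rw [hx, Pi.smul_apply, smul_eq_mul, mul_assoc]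
  have e₂ : ∫ x : ℝ, ((x : ℂ) * (c • f) x) * conj ((x : ℂ) * g x)
      = c * ∫ x : ℝ, ((x : ℂ) * f x) * conj ((x : ℂ) * g x) := by
    rw [← integral_const_mul]
    refine integral_congr_ae (Filter.Eventually.of_forall fun x => ?_)
    simp only [Pi.smul_apply, smul_eq_mul]
    ring
  have e₃ : ∫ x, (c • f) x * conj (g x) = c * ∫ x, f x * conj (g x) := by
    rw [← integral_const_mul]
    refine integral_congr_ae (Filter.Eventually.of_forall fun x => ?_)
    simp only [Pi.smul_apply, smul_eq_mul]
    ring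
  unfold form
  rw [e₁, e₂, e₃]
  simp only [Pi.smul_apply, smul_eq_mul]
  ring

/-- The Hilbert space `L²(ℝ)`. -/
abbrev L2 : Type := Lp ℂ 2 (volume : Measure ℝ)

/-- The graph of the operator associated with the form: `(f, h)` belongs to it when `f` lies in
the form domain and `t(f, g) = ⟨h, g⟩` for all `g` in the form domain. -/
def operatorGraph (z : ℂ) (b : ℝ) : Submodule ℂ (L2 × L2) where
  carrier := {p | ∃ f ∈ formDomain, p.1 =ᵐ[volume] f ∧
    ∀ g ∈ formDomain, form z b f g = ∫ x, p.2 x * conj (g x)}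
  zero_mem' := by
    refine ⟨0, formDomain.zero_mem, Lp.coeFn_zero _ _ _, fun g _ => ?_⟩
    have h := form_smul_left z b 0 (g := g) formDomain.zero_mem
    rw [zero_smul, zero_mul] at h
    rw [h]
    symm
    apply integral_eq_zero_of_ae
    filter_upwards [Lp.coeFn_zero ℂ 2 (volume : Measure ℝ)] with x hx
    simp only [Prod.snd_zero, hx, Pi.zero_apply, zero_mul]
  add_mem' := by
    rintro p q ⟨f₁, h₁, e₁, t₁⟩ ⟨f₂, h₂, e₂, t₂⟩
    refine ⟨f₁ + f₂, formDomain.add_mem h₁ h₂, (Lp.coeFn_add _ _).trans (e₁.add e₂),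
      fun g hg => ?_⟩
    rw [form_add_left z b h₁ h₂ hg, t₁ g hg, t₂ g hg,
      ← integral_add (integrable_mul_conj (Lp.memLp _) hg.2.1)
        (integrable_mul_conj (Lp.memLp _) hg.2.1)]
    refine integral_congr_ae ?_
    filter_upwards [Lp.coeFn_add p.2 q.2] with x hx
    rw [Prod.snd_add, hx, Pi.add_apply, add_mul]
  smul_mem' := by
    rintro c p ⟨f, h, e, t⟩
    refine ⟨c • f, formDomain.smul_mem c h, (Lp.coeFn_smul _ _).trans (e.const_smul c),
      fun g hg => ?_⟩
    rw [form_smul_left z b c h, t g hg, ← integral_const_mul]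
    refine integral_congr_ae ?_
    filter_upwards [Lp.coeFn_smul c p.2] with x hx
    rw [Prod.smul_snd, hx, Pi.smul_apply, smul_eq_mul, mul_assoc]

/-- The operator `L_{z,b} = -d²/dx² + (x²/4 - 1/2) + z (δ(x - b) - δ(x + b))` on `L²(ℝ)`, defined
by its form. -/
def operator (z : ℂ) (b : ℝ) : L2 →ₗ.[ℂ] L2 := (operatorGraph z b).toLinearPMap

theorem test_mem_formDomain {φ : ℝ → ℝ} (hφ : ContDiff ℝ ∞ φ) (hc : HasCompactSupport φ) :
    (fun x => (φ x : ℂ)) ∈ formDomain := by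
  have hC : Continuous fun x => (φ x : ℂ) := Complex.continuous_ofReal.comp hφ.continuous
  have hcC : HasCompactSupport fun x => (φ x : ℂ) := hc.comp_left Complex.ofReal_zero
  have hd : Continuous (deriv φ) := hφ.continuous_deriv (by simp)
  have hdC : Continuous fun x => ((deriv φ x : ℝ) : ℂ) := Complex.continuous_ofReal.comp hd
  refine ⟨hC, hC.memLp_of_hasCompactSupport hcC, ⟨fun x => ((deriv φ x : ℝ) : ℂ),
    hdC.memLp_of_hasCompactSupport (hc.deriv.comp_left Complex.ofReal_zero), ?_⟩, ?_⟩
  · intro ψ hψ hψc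
    have hψd : Continuous (deriv ψ) := hψ.continuous_deriv (by simp)
    have key := integral_mul_deriv_eq_deriv_mul_of_integrable (u := φ) (v := ψ)
      (u' := deriv φ) (v' := deriv ψ)
      (fun x _ => (hφ.differentiable (by simp) x).hasDerivAt)
      (fun x _ => (hψ.differentiable (by simp) x).hasDerivAt)
      ((hφ.continuous.mul hψd).integrable_of_hasCompactSupport hc.mul_right)
      ((hd.mul hψ.continuous).integrable_of_hasCompactSupport hc.deriv.mul_right)
      ((hφ.continuous.mul hψ.continuous).integrable_of_hasCompactSupport hc.mul_right)
    have e₁ : ∫ x, deriv ψ x • (φ x : ℂ) = ((∫ x, φ x * deriv ψ x : ℝ) : ℂ) := by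
      rw [← integral_complex_ofReal]
      refine integral_congr_ae (Filter.Eventually.of_forall fun x => ?_)
      simp [mul_comm]
    have e₂ : ∫ x, ψ x • ((deriv φ x : ℝ) : ℂ) = ((∫ x, deriv φ x * ψ x : ℝ) : ℂ) := by
      rw [← integral_complex_ofReal]
      refine integral_congr_ae (Filter.Eventually.of_forall fun x => ?_)
      simp [mul_comm]
    rw [e₁, e₂, key, Complex.ofReal_neg]
  · exact (Complex.continuous_ofReal.mul hC).memLp_of_hasCompactSupport hcC.mul_left

/-- The graph is single-valued, so `operator z b` really has graph `operatorGraph z b`. -/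
theorem operator_graph (z : ℂ) (b : ℝ) : (operator z b).graph = operatorGraph z b := by
  refine Submodule.toLinearPMap_graph_eq _ ?_
  rintro ⟨p, h⟩ ⟨f, hf, e, t⟩ hp
  simp only at hp e t
  subst hp
  have hf0 : f = 0 := by
    refine (hf.1.ae_eq_iff_eq volume continuous_zero).1 ?_
    exact e.symm.trans (Lp.coeFn_zero _ _ _)
  subst hf0
  have ht : ∀ g ∈ formDomain, ∫ x, h x * conj (g x) = 0 := fun g hg => by
    have h0 := form_smul_left z b 0 (g := g) formDomain.zero_mem
    rw [zero_smul, zero_mul] at h0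
    rw [← t g hg, h0]
  rw [Lp.eq_zero_iff_ae_eq_zero]
  refine ae_eq_zero_of_integral_contDiff_smul_eq_zero
    ((Lp.memLp h).locallyIntegrable (by norm_num)) fun φ hφ hc => ?_
  rw [← ht _ (test_mem_formDomain hφ hc)]
  refine integral_congr_ae (Filter.Eventually.of_forall fun x => ?_)
  simp [mul_comm]

/-! ### Parabolic cylinder functions -/

/-- The even solution of `-y'' + (x²/4 - 1/2) y = ν y` with `y(0) = 1`. -/
def yEven (ν x : ℂ) : ℂ :=
  Complex.exp (-x ^ 2 / 4) *
    ∑' k : ℕ, (∏ j ∈ Finset.range k, (-ν + 2 * (j : ℂ))) * (x ^ (2 * k) / ((2 * k).factorial : ℂ))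

/-- The odd solution of `-y'' + (x²/4 - 1/2) y = ν y` with `y'(0) = 1`. -/
def yOdd (ν x : ℂ) : ℂ :=
  Complex.exp (-x ^ 2 / 4) *
    ∑' k : ℕ, (∏ j ∈ Finset.range k, (-ν + (2 * (j : ℂ) + 1))) *
      (x ^ (2 * k + 1) / ((2 * k + 1).factorial : ℂ))

/-- The parabolic cylinder function `D_ν(x)`: the solution of `-y'' + (x²/4 - 1/2) y = ν y` with
`y(0) = 2^{ν/2} √π / Γ((1-ν)/2)` and `y'(0) = -2^{(ν+1)/2} √π / Γ(-ν/2)`. The quotient by `Γ` is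
`0` at the poles of `Γ`, in accordance with `1/Γ` being entire. -/
def parabolicD (ν x : ℂ) : ℂ :=
  (2 : ℂ) ^ (ν / 2) * (√Real.pi : ℂ) / Complex.Gamma (-ν / 2 + 1 / 2) * yEven ν x
    - (2 : ℂ) ^ ((ν + 1) / 2) * (√Real.pi : ℂ) / Complex.Gamma (-ν / 2) * yOdd ν x

/-- `M(ν; b) = √(2/π) Γ(-ν) D_ν(b)² y_even(ν, b) y_odd(ν, b)`, meaningful for `ν ∉ ℕ₀`. -/
def M (ν : ℂ) (b : ℝ) : ℂ :=
  (√(2 / Real.pi) : ℂ) * Complex.Gamma (-ν) * parabolicD ν b ^ 2 * yEven ν b * yOdd ν b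

end PointInteraction

end

/-!
Start with `D_ν(-x)`, the solution of Weber's equation that decays at `-∞`, and apply the jumps of
its derivative at `-b` and at `b`. Up to the factor `-√(2π)`, the Wronskian with `D_ν` of the
solution obtained beyond `b` is the left-hand side of the characteristic equation. If it vanishes,
that solution decays at `+∞` too and is an eigenfunction. If not, adding a suitable multiple of it
to the solution with an additional unit jump at `p` produces a Green function with pole `p`, and
testing `t(f, ·) = ν ⟨f, ·⟩` against its conjugate gives `f(p) = 0`.

In the second case the bounded operator representing `t - ν` on the form domain is thus injective.
On the functions that vanish on a sufficiently fine finite grid containing `±b`, the point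
interactions drop out and `‖f‖² ≤ ε (‖f'‖² + ‖x f‖²)`, so the form is coercive there; an injective
operator that is coercive on a subspace of finite codimension is bijective, and the resolvent is
read off from its inverse.

As a function of `ν`, `M` is `Γ(-ν)` times an entire function that does not vanish at `0`.
-/

noncomputable section

namespace PointInteraction

open Filter Set Asymptotics

section Series

/-- The divided power `xⁿ / n!`. -/
def divPow (n : ℕ) (x : ℂ) : ℂ := x ^ n / (n.factorial : ℂ)

theorem hasDerivAt_divPow_succ (n : ℕ) (x : ℂ) : HasDerivAt (divPow (n + 1)) (divPow n x) x := by
  have h := (hasDerivAt_pow (n + 1) x).div_const ((n + 1).factorial : ℂ)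
  refine h.congr_deriv ?_
  rw [divPow, Nat.factorial_succ, Nat.cast_mul, Nat.add_sub_cancel,
    mul_div_mul_left _ _ (Nat.cast_ne_zero.2 n.succ_ne_zero)]

theorem mul_divPow (n : ℕ) (x : ℂ) : x * divPow n x = (n + 1) * divPow (n + 1) x := by
  have hn : ((n : ℂ) + 1) ≠ 0 := Nat.cast_add_one_ne_zero n
  rw [divPow, divPow, Nat.factorial_succ, Nat.cast_mul, pow_succ]
  push_cast
  field_simp

theorem norm_divPow (n : ℕ) (x : ℂ) : ‖divPow n x‖ = ‖x‖ ^ n / n.factorial := by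
  rw [divPow, norm_div, norm_pow, Complex.norm_natCast]

theorem divPow_neg (n : ℕ) (x : ℂ) : divPow n (-x) = (-1) ^ n * divPow n x := by
  rw [divPow, divPow, neg_pow, mul_div_assoc]

theorem conj_divPow (n : ℕ) (x : ℂ) : conj (divPow n x) = divPow n (conj x) := by
  simp only [divPow, map_div₀, map_pow, Complex.conj_natCast]

/-- The product `∏_{j<k} (2j - ν)`, the `k`-th power series coefficient of the even solution. -/
def cylCoeff (ν : ℂ) (k : ℕ) : ℂ := ∏ j ∈ Finset.range k, (-ν + 2 * (j : ℂ))

theorem cylCoeff_zero (ν : ℂ) : cylCoeff ν 0 = 1 := Finset.prod_range_zero _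

theorem cylCoeff_succ (ν : ℂ) (k : ℕ) : cylCoeff ν (k + 1) = cylCoeff ν k * (-ν + 2 * k) :=
  Finset.prod_range_succ _ _

theorem cylCoeff_succ' (ν : ℂ) (k : ℕ) : cylCoeff ν (k + 1) = -ν * cylCoeff (ν - 2) k := by
  rw [cylCoeff, Finset.prod_range_succ', mul_comm, cylCoeff]
  congr 1
  · simp
  · refine Finset.prod_congr rfl fun j _ => ?_
    push_cast
    ring

theorem conj_cylCoeff (ν : ℂ) (k : ℕ) : conj (cylCoeff ν k) = cylCoeff (conj ν) k := by
  simp only [cylCoeff, map_prod, map_add, map_neg, map_mul, Complex.conj_natCast,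
    Complex.conj_ofNat]

theorem differentiable_cylCoeff (k : ℕ) : Differentiable ℂ fun ν => cylCoeff ν k := by
  unfold cylCoeff
  fun_prop

theorem norm_cylCoeff_le (ν : ℂ) (k : ℕ) :
    ‖cylCoeff ν k‖ ≤ (‖ν‖ + 1) ^ k * ((2 * k).factorial / k.factorial) := by
  induction k with
  | zero => simp [cylCoeff_zero]
  | succ k ih =>
    have hk : (0 : ℝ) ≤ k := k.cast_nonneg
    have hfactor : ‖-ν + 2 * (k : ℂ)‖ ≤ (‖ν‖ + 1) * (2 * (2 * k + 1)) := by
      refine (norm_add_le _ _).trans ?_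
      simp only [norm_neg, norm_mul, Complex.norm_ofNat, Complex.norm_natCast]
      nlinarith [mul_nonneg (norm_nonneg ν) hk, norm_nonneg ν]
    have hfactorial : ((2 * (k + 1)).factorial : ℝ) / (k + 1).factorial
        = (2 * k).factorial / k.factorial * (2 * (2 * k + 1)) := by
      rw [show 2 * (k + 1) = 2 * k + 1 + 1 by ring]
      simp only [Nat.factorial_succ, Nat.cast_mul]
      push_cast
      field_simp
      ring
    rw [cylCoeff_succ, norm_mul, hfactorial, pow_succ]
    calc ‖cylCoeff ν k‖ * ‖-ν + 2 * (k : ℂ)‖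
        ≤ (‖ν‖ + 1) ^ k * ((2 * k).factorial / k.factorial) *
          ((‖ν‖ + 1) * (2 * (2 * k + 1))) := by gcongr
      _ = _ := by ring

theorem norm_cylCoeff_mul_divPow_le {ν x : ℂ} {r R : ℝ} (hν : ‖ν‖ ≤ r) (hx : ‖x‖ ≤ R)
    (m k : ℕ) :
    ‖cylCoeff ν k * divPow (2 * k + m) x‖ ≤ R ^ m * (((r + 1) * R ^ 2) ^ k / k.factorial) := by
  have hR : 0 ≤ R := (norm_nonneg x).trans hx
  have hr : 0 ≤ r := (norm_nonneg ν).trans hν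
  have hfactorial : ((2 * k).factorial : ℝ) ≤ (2 * k + m).factorial :=
    Nat.cast_le.2 (Nat.factorial_le (Nat.le_add_right _ _))
  rw [norm_mul, norm_divPow]
  calc ‖cylCoeff ν k‖ * (‖x‖ ^ (2 * k + m) / (2 * k + m).factorial)
      ≤ ((r + 1) ^ k * ((2 * k).factorial / k.factorial)) *
          (R ^ (2 * k + m) / (2 * k).factorial) := by
        gcongr
        exact (norm_cylCoeff_le ν k).trans (by gcongr)
    _ = _ := by
        rw [mul_pow, ← pow_mul, pow_add]
        field_simp

/-- The series `∑ₖ ∏_{j<k} (2j - ν) x^(2k+m) / (2k+m)!`. The even and the odd solution are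
`e^(-x²/4)` times `cylSeries ν 0` and `cylSeries (ν - 1) 1`; allowing every shift `m` lets both be
treated at once. -/
def cylSeries (ν : ℂ) (m : ℕ) (x : ℂ) : ℂ := ∑' k : ℕ, cylCoeff ν k * divPow (2 * k + m) x

theorem summable_cylSeries (ν : ℂ) (m : ℕ) (x : ℂ) :
    Summable fun k : ℕ => cylCoeff ν k * divPow (2 * k + m) x :=
  .of_norm_bounded ((Real.summable_pow_div_factorial _).mul_left _)
    (norm_cylCoeff_mul_divPow_le le_rfl le_rfl m)

theorem hasDerivAt_cylSeries_succ (ν : ℂ) (m : ℕ) (x : ℂ) :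
    HasDerivAt (cylSeries ν (m + 1)) (cylSeries ν m x) x := by
  refine hasDerivAt_tsum_of_isPreconnected (t := Metric.ball 0 (‖x‖ + 1)) (y₀ := x)
    ((Real.summable_pow_div_factorial ((‖ν‖ + 1) * (‖x‖ + 1) ^ 2)).mul_left ((‖x‖ + 1) ^ m))
    Metric.isOpen_ball (convex_ball _ _).isPreconnected
    (fun k y _ => (hasDerivAt_divPow_succ _ y).const_mul _)
    (fun k y hy => ?_) (by simp) (summable_cylSeries ν (m + 1) x) (by simp)
  exact norm_cylCoeff_mul_divPow_le le_rfl (by simpa using (Metric.mem_ball.1 hy).le) m k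

theorem differentiable_cylSeries_left (m : ℕ) (x : ℂ) :
    Differentiable ℂ fun ν => cylSeries ν m x := by
  intro ν
  refine DifferentiableOn.differentiableAt (s := Metric.ball 0 (‖ν‖ + 1)) ?_
    (Metric.isOpen_ball.mem_nhds (by simp))
  exact Complex.differentiableOn_tsum_of_summable_norm
    ((Real.summable_pow_div_factorial _).mul_left _)
    (fun k => ((differentiable_cylCoeff k).mul_const _).differentiableOn) Metric.isOpen_ball
    fun k w hw => norm_cylCoeff_mul_divPow_le (by simpa using (Metric.mem_ball.1 hw).le) le_rfl m k

theorem cylSeries_zero_shift (ν x : ℂ) : cylSeries ν 0 x = 1 - ν * cylSeries (ν - 2) 2 x := by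
  rw [cylSeries, (summable_cylSeries ν 0 x).tsum_eq_zero_add, sub_eq_add_neg, ← neg_mul, cylSeries,
    ← tsum_mul_left]
  congr 1
  · simp [cylCoeff_zero, divPow]
  · exact tsum_congr fun k => by rw [cylCoeff_succ', mul_assoc, add_zero, mul_add_one]

theorem mul_cylSeries (ν : ℂ) (m : ℕ) (x : ℂ) :
    x * cylSeries ν m x
      = -ν * cylSeries (ν - 2) (m + 1) x + (ν + m + 1) * cylSeries ν (m + 1) x := by
  simp only [cylSeries, ← tsum_mul_left]
  rw [← ((summable_cylSeries _ _ _).mul_left _).tsum_add ((summable_cylSeries _ _ _).mul_left _)]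
  refine tsum_congr fun k => ?_
  rw [mul_left_comm, mul_divPow, ← mul_assoc (-ν), ← cylCoeff_succ', cylCoeff_succ, ← add_assoc]
  push_cast
  ring

theorem cylSeries_neg (ν : ℂ) (m : ℕ) (x : ℂ) :
    cylSeries ν m (-x) = (-1) ^ m * cylSeries ν m x := by
  simp only [cylSeries, ← tsum_mul_left]
  refine tsum_congr fun k => ?_
  rw [divPow_neg, pow_add, (even_two_mul k).neg_one_pow, one_mul, mul_left_comm]

theorem conj_cylSeries (ν : ℂ) (m : ℕ) (x : ℂ) :
    conj (cylSeries ν m x) = cylSeries (conj ν) m (conj x) := by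
  simp only [cylSeries, Complex.conj_tsum, map_mul, conj_cylCoeff, conj_divPow]

theorem yEven_eq (ν x : ℂ) : yEven ν x = Complex.exp (-x ^ 2 / 4) * cylSeries ν 0 x := rfl

theorem yOdd_eq (ν x : ℂ) : yOdd ν x = Complex.exp (-x ^ 2 / 4) * cylSeries (ν - 1) 1 x := by
  have hcoeff (k : ℕ) : ∏ j ∈ Finset.range k, (-ν + (2 * (j : ℂ) + 1)) = cylCoeff (ν - 1) k :=
    Finset.prod_congr rfl fun j _ => by ring
  simp only [yOdd, cylSeries, hcoeff, divPow]

end Series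

section Ladder

theorem hasDerivAt_exp_neg_sq_div_four (x : ℂ) :
    HasDerivAt (fun y : ℂ => Complex.exp (-y ^ 2 / 4)) (-(x / 2) * Complex.exp (-x ^ 2 / 4)) x := by
  refine (((hasDerivAt_pow 2 x).neg).div_const 4).cexp.congr_deriv ?_
  simp only [Nat.cast_ofNat, Pi.neg_apply]
  ring

theorem hasDerivAt_yEven (ν x : ℂ) :
    HasDerivAt (yEven ν) (-(x / 2) * yEven ν x - ν * yOdd (ν - 1) x) x := by
  have hseries : HasDerivAt (cylSeries ν 0) (-(ν * cylSeries (ν - 1 - 1) 1 x)) x := by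
    rw [sub_sub, one_add_one_eq_two, funext (cylSeries_zero_shift ν)]
    exact ((hasDerivAt_cylSeries_succ (ν - 2) 1 x).const_mul ν).const_sub 1
  refine ((hasDerivAt_exp_neg_sq_div_four x).mul hseries).congr_deriv ?_
  rw [yEven_eq, yOdd_eq]
  ring

theorem hasDerivAt_yOdd (ν x : ℂ) :
    HasDerivAt (yOdd ν) (-(x / 2) * yOdd ν x + yEven (ν - 1) x) x := by
  rw [funext (yOdd_eq ν), yEven_eq]
  refine ((hasDerivAt_exp_neg_sq_div_four x).mul
    (hasDerivAt_cylSeries_succ (ν - 1) 0 x)).congr_deriv ?_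
  ring

theorem mul_yEven (ν x : ℂ) :
    x * yEven ν x = -ν * yOdd (ν - 1) x + (1 + ν) * yOdd (ν + 1) x := by
  have h := mul_cylSeries ν 0 x
  rw [yEven_eq, yOdd_eq, yOdd_eq, sub_sub, one_add_one_eq_two, add_sub_cancel_right]
  push_cast at h
  linear_combination Complex.exp (-x ^ 2 / 4) * h

theorem mul_yOdd (ν x : ℂ) : x * yOdd ν x = yEven (ν - 1) x - yEven (ν + 1) x := by
  have h := mul_cylSeries (ν - 1) 1 x
  rw [yOdd_eq, yEven_eq, yEven_eq, cylSeries_zero_shift, cylSeries_zero_shift (ν + 1),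
    show ν + 1 - 2 = ν - 1 by ring]
  push_cast at h
  linear_combination Complex.exp (-x ^ 2 / 4) * h

theorem yEven_zero_right (ν : ℂ) : yEven ν 0 = 1 := by
  rw [yEven_eq, cylSeries, tsum_eq_single 0 fun k hk => by simp [divPow, hk]]
  simp [cylCoeff_zero, divPow]

theorem yOdd_zero_right (ν : ℂ) : yOdd ν 0 = 0 := by
  simp [yOdd_eq, cylSeries, divPow]

theorem yEven_neg (ν x : ℂ) : yEven ν (-x) = yEven ν x := by
  simp only [yEven_eq, neg_sq, cylSeries_neg, pow_zero, one_mul]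

theorem yOdd_neg (ν x : ℂ) : yOdd ν (-x) = -yOdd ν x := by
  simp only [yOdd_eq, neg_sq, cylSeries_neg, pow_one, neg_one_mul, mul_neg]

theorem conj_yEven (ν x : ℂ) : conj (yEven ν x) = yEven (conj ν) (conj x) := by
  simp only [yEven_eq, map_mul, ← Complex.exp_conj, conj_cylSeries, map_div₀, map_neg, map_pow,
    Complex.conj_ofNat]

theorem conj_yOdd (ν x : ℂ) : conj (yOdd ν x) = yOdd (conj ν) (conj x) := by
  simp only [yOdd_eq, map_mul, ← Complex.exp_conj, conj_cylSeries, map_div₀, map_neg, map_pow,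
    Complex.conj_ofNat, map_sub, map_one]

theorem differentiable_yEven_left (x : ℂ) : Differentiable ℂ fun ν => yEven ν x :=
  (differentiable_cylSeries_left 0 x).const_mul _

theorem differentiable_yOdd_left (x : ℂ) : Differentiable ℂ fun ν => yOdd ν x := by
  simp only [yOdd_eq]
  exact ((differentiable_cylSeries_left 1 x).comp (differentiable_id.sub_const 1)).const_mul _

end Ladder

section ParabolicCylinder

theorem two_cpow_ne_zero (w : ℂ) : (2 : ℂ) ^ w ≠ 0 := by simp [Complex.cpow_eq_zero_iff]

theorem ofReal_sqrt_pi_ne_zero : (√Real.pi : ℂ) ≠ 0 :=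
  Complex.ofReal_ne_zero.2 (Real.sqrt_pos.2 Real.pi_pos).ne'

theorem ofReal_sqrt_two_mul_pi :
    (√(2 * Real.pi) : ℂ) = (2 : ℂ) ^ (1 / 2 : ℂ) * (√Real.pi : ℂ) := by
  rw [Real.sqrt_mul zero_le_two, Real.sqrt_eq_rpow 2, Complex.ofReal_mul,
    Complex.ofReal_cpow zero_le_two]
  norm_num

/-- The coefficient of the even solution in `D_ν`, that is `D_ν(0)`. -/
def evenWeight (ν : ℂ) : ℂ :=
  (2 : ℂ) ^ (ν / 2) * (√Real.pi : ℂ) / Complex.Gamma (-ν / 2 + 1 / 2)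

/-- The coefficient of minus the odd solution in `D_ν`, that is `-D_ν'(0)`. -/
def oddWeight (ν : ℂ) : ℂ :=
  (2 : ℂ) ^ ((ν + 1) / 2) * (√Real.pi : ℂ) / Complex.Gamma (-ν / 2)

theorem parabolicD_eq (ν x : ℂ) :
    parabolicD ν x = evenWeight ν * yEven ν x - oddWeight ν * yOdd ν x := rfl

theorem evenWeight_add_one (ν : ℂ) : evenWeight (ν + 1) = oddWeight ν := by
  rw [evenWeight, oddWeight, show -(ν + 1) / 2 + 1 / 2 = -ν / 2 by ring]

theorem evenWeight_eq_oddWeight_sub_one (ν : ℂ) : evenWeight ν = oddWeight (ν - 1) := by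
  rw [← evenWeight_add_one, sub_add_cancel]

theorem oddWeight_add_one (ν : ℂ) : oddWeight (ν + 1) = -(1 + ν) * evenWeight ν := by
  have h := Complex.one_div_Gamma_eq_self_mul_one_div_Gamma_add_one (-(ν + 1) / 2)
  rw [show -(ν + 1) / 2 + 1 = -ν / 2 + 1 / 2 by ring] at h
  rw [oddWeight, evenWeight, show (ν + 1 + 1) / 2 = ν / 2 + 1 by ring,
    Complex.cpow_add _ _ two_ne_zero, Complex.cpow_one, div_eq_mul_inv, h]
  ring

theorem oddWeight_eq_neg_mul_evenWeight (ν : ℂ) : oddWeight ν = -ν * evenWeight (ν - 1) := by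
  simpa using oddWeight_add_one (ν - 1)

theorem evenWeight_ne_zero_or_oddWeight_ne_zero (ν : ℂ) :
    evenWeight ν ≠ 0 ∨ oddWeight ν ≠ 0 := by
  by_contra! h
  simp only [evenWeight, oddWeight, div_eq_zero_iff, mul_eq_zero, ofReal_sqrt_pi_ne_zero,
    two_cpow_ne_zero, or_false, false_or, Complex.Gamma_eq_zero_iff] at h
  obtain ⟨⟨m, hm⟩, n, hn⟩ := h
  have hparity : ((2 * m + 1 : ℤ) : ℂ) = ((2 * n : ℤ) : ℂ) := by
    push_cast
    linear_combination 2 * hm - 2 * hn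
  have := Int.cast_injective hparity
  omega

theorem inv_Gamma_mul_inv_Gamma_add_half (ν : ℂ) :
    (Complex.Gamma (-ν / 2))⁻¹ * (Complex.Gamma (-ν / 2 + 1 / 2))⁻¹
      = (Complex.Gamma (-ν))⁻¹ * (2 * (2 : ℂ) ^ ν * (√Real.pi : ℂ))⁻¹ := by
  have hduplication := Complex.Gamma_mul_Gamma_add_half (-ν / 2)
  rw [show 2 * (-ν / 2) = -ν by ring, sub_neg_eq_add, Complex.cpow_add _ _ two_ne_zero,
    Complex.cpow_one] at hduplication
  rw [← mul_inv, hduplication, ← mul_inv, mul_assoc]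

theorem sqrt_two_pi_mul_inv_Gamma (ν : ℂ) :
    (√(2 * Real.pi) : ℂ) * (Complex.Gamma (-ν))⁻¹ = 2 * (evenWeight ν * oddWeight ν) := by
  have hpow : (2 : ℂ) ^ (ν / 2) * 2 ^ ((ν + 1) / 2) = 2 ^ (1 / 2 : ℂ) * 2 ^ ν := by
    rw [← Complex.cpow_add _ _ two_ne_zero, ← Complex.cpow_add _ _ two_ne_zero]
    ring_nf
  have hpi := ofReal_sqrt_pi_ne_zero
  have htwo := two_cpow_ne_zero ν
  calc (√(2 * Real.pi) : ℂ) * (Complex.Gamma (-ν))⁻¹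
      = 2 * (2 ^ (1 / 2 : ℂ) * 2 ^ ν) * (√Real.pi : ℂ) ^ 2 *
        ((Complex.Gamma (-ν))⁻¹ * (2 * (2 : ℂ) ^ ν * (√Real.pi : ℂ))⁻¹) := by
        rw [ofReal_sqrt_two_mul_pi]
        field_simp
    _ = 2 * (evenWeight ν * oddWeight ν) := by
        rw [← inv_Gamma_mul_inv_Gamma_add_half, ← hpow, evenWeight, oddWeight, div_eq_mul_inv,
          div_eq_mul_inv]
        ring

theorem hasDerivAt_parabolicD (ν x : ℂ) :
    HasDerivAt (parabolicD ν) (-(x / 2) * parabolicD ν x + ν * parabolicD (ν - 1) x) x := by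
  refine (((hasDerivAt_yEven ν x).const_mul (evenWeight ν)).sub
    ((hasDerivAt_yOdd ν x).const_mul (oddWeight ν))).congr_deriv ?_
  rw [parabolicD_eq, parabolicD_eq, ← evenWeight_eq_oddWeight_sub_one]
  linear_combination (-yEven (ν - 1) x) * oddWeight_eq_neg_mul_evenWeight ν

theorem parabolicD_add_one (ν x : ℂ) :
    parabolicD (ν + 1) x = x * parabolicD ν x - ν * parabolicD (ν - 1) x := by
  simp only [parabolicD_eq, evenWeight_add_one, oddWeight_add_one,
    ← evenWeight_eq_oddWeight_sub_one]
  linear_combination (-evenWeight ν) * mul_yEven ν x + oddWeight ν * mul_yOdd ν x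
    + yEven (ν - 1) x * oddWeight_eq_neg_mul_evenWeight ν

theorem conj_two_cpow (w : ℂ) : conj ((2 : ℂ) ^ w) = 2 ^ conj w := by
  have harg : (2 : ℂ).arg ≠ Real.pi := by
    rw [Complex.ofNat_arg]
    exact Real.pi_ne_zero.symm
  rw [Complex.cpow_conj _ _ harg, Complex.conj_ofNat]

theorem conj_parabolicD (ν x : ℂ) : conj (parabolicD ν x) = parabolicD (conj ν) (conj x) := by
  simp only [parabolicD, map_sub, map_mul, map_div₀, conj_two_cpow, ← Complex.Gamma_conj,
    conj_yEven, conj_yOdd, Complex.conj_ofReal, map_add, map_neg, map_one, Complex.conj_ofNat]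

end ParabolicCylinder

section IntegralRepresentation

theorem two_cpow_mul_Gamma_add_nat {s : ℂ} (hs : 0 < s.re) (k : ℕ) :
    (2 : ℂ) ^ (s / 2 + k) * Complex.Gamma (s / 2 + k)
      = 2 ^ (s / 2) * Complex.Gamma (s / 2) * cylCoeff (-s) k := by
  induction k with
  | zero => simp [cylCoeff_zero]
  | succ k ih =>
    have hne : s / 2 + k ≠ 0 := fun h => by
      have hre : s.re / 2 + k = 0 := by simpa using congrArg Complex.re h
      linarith [k.cast_nonneg (α := ℝ)]
    rw [cylCoeff_succ, ← mul_assoc, ← ih, Nat.cast_succ, ← add_assoc, Complex.Gamma_add_one _ hne,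
      Complex.cpow_add _ _ two_ne_zero, Complex.cpow_one]
    ring

theorem integral_cpow_mul_gaussian {s : ℂ} (hs : 0 < s.re) :
    ∫ t : ℝ in Ioi 0, (t : ℂ) ^ (s - 1) * Complex.exp (-(t : ℂ) ^ 2 / 2)
      = 1 / 2 * ((2 : ℂ) ^ (s / 2) * Complex.Gamma (s / 2)) := by
  have hGamma := Complex.integral_cpow_mul_exp_neg_mul_Ioi (a := s / 2) (r := 1 / 2)
    (by simpa using hs) (by norm_num)
  rw [← integral_comp_rpow_Ioi (p := 2) _ two_ne_zero] at hGamma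
  rw [show (1 / ((1 / 2 : ℝ) : ℂ)) = 2 by norm_num] at hGamma
  rw [← hGamma, ← integral_const_mul]
  refine setIntegral_congr_fun measurableSet_Ioi fun t ht => ?_
  have htpos : 0 < t := ht
  have ht0 : (t : ℂ) ≠ 0 := Complex.ofReal_ne_zero.2 htpos.ne'
  have hsq : ((t ^ (2 : ℝ) : ℝ) : ℂ) = (t : ℂ) ^ 2 := by norm_num
  have hpow : ((t : ℂ) ^ 2) ^ (s / 2 - 1) * t = (t : ℂ) ^ (s - 1) := by
    rw [pow_two, Complex.mul_cpow_ofReal_nonneg htpos.le htpos.le,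
      show s - 1 = s / 2 - 1 + (s / 2 - 1) + 1 by ring, Complex.cpow_add _ _ ht0,
      Complex.cpow_add _ _ ht0, Complex.cpow_one]
  simp only [hsq, Complex.real_smul]
  rw [← hpow]
  norm_num
  ring_nf

theorem integrableOn_rpow_mul_exp_sub_sq {σ : ℝ} (hσ : 0 < σ) (a : ℝ) :
    IntegrableOn (fun t : ℝ => t ^ (σ - 1) * Real.exp (a * t - t ^ 2 / 2)) (Ioi 0) := by
  refine Integrable.mono' ((Real.GammaIntegral_convergent hσ).const_mul
    (Real.exp ((a + 1) ^ 2 / 2))) ?_ ?_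
  · refine ContinuousOn.aestronglyMeasurable ?_ measurableSet_Ioi
    refine ContinuousOn.mul (fun t ht => ?_) (by fun_prop)
    exact (Real.continuousAt_rpow_const _ _ (Or.inl (ne_of_gt ht))).continuousWithinAt
  · refine (ae_restrict_iff' measurableSet_Ioi).2 (Eventually.of_forall fun t ht => ?_)
    have hpow : 0 ≤ t ^ (σ - 1) := Real.rpow_nonneg (le_of_lt ht) _
    rw [Real.norm_of_nonneg (by positivity)]
    calc t ^ (σ - 1) * Real.exp (a * t - t ^ 2 / 2)
        ≤ t ^ (σ - 1) * Real.exp ((a + 1) ^ 2 / 2 + -t) := by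
          gcongr
          linarith [sq_nonneg (t - (a + 1))]
      _ = Real.exp ((a + 1) ^ 2 / 2) * (Real.exp (-t) * t ^ (σ - 1)) := by
          rw [Real.exp_add]
          ring

theorem norm_cpow_mul_gaussian (s : ℂ) {t : ℝ} (ht : 0 < t) :
    ‖(t : ℂ) ^ (s - 1) * Complex.exp (-(t : ℂ) ^ 2 / 2)‖
      = t ^ (s.re - 1) * Real.exp (-t ^ 2 / 2) := by
  rw [norm_mul, Complex.norm_cpow_eq_rpow_re_of_pos ht, Complex.norm_exp]
  norm_cast

theorem aestronglyMeasurable_cpow_mul_gaussian (s : ℂ) :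
    AEStronglyMeasurable (fun t : ℝ => (t : ℂ) ^ (s - 1) * Complex.exp (-(t : ℂ) ^ 2 / 2))
      (volume.restrict (Ioi 0)) := by
  refine ContinuousOn.aestronglyMeasurable ?_ measurableSet_Ioi
  refine ContinuousOn.mul (fun t ht => ?_) (by fun_prop)
  exact (Complex.continuousAt_ofReal_cpow_const t _ (Or.inr (ne_of_gt ht))).continuousWithinAt

theorem hasSum_integral_cpow_mul_gaussian_mul_exp {s : ℂ} (hs : 0 < s.re) (x : ℝ) :
    HasSum (fun k : ℕ => (-x : ℂ) ^ k / (k.factorial : ℂ) *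
        ∫ t : ℝ in Ioi 0, (t : ℂ) ^ (s + k - 1) * Complex.exp (-(t : ℂ) ^ 2 / 2))
      (∫ t : ℝ in Ioi 0, (t : ℂ) ^ (s - 1) * Complex.exp (-(t : ℂ) ^ 2 / 2) *
        Complex.exp (-x * t)) := by
  simp_rw [← integral_const_mul]
  refine hasSum_integral_of_dominated_convergence
    (fun k t => t ^ (s.re - 1) * Real.exp (-t ^ 2 / 2) * ((|x| * t) ^ k / k.factorial))
    (fun k => (aestronglyMeasurable_cpow_mul_gaussian (s + k)).const_mul _) (fun k => ?_)
    (Eventually.of_forall fun t => (Real.summable_pow_div_factorial _).mul_left _) ?_ ?_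
  · refine (ae_restrict_iff' measurableSet_Ioi).2 (Eventually.of_forall fun t ht => ?_)
    have hre : (s + k).re - 1 = (s.re - 1) + k := by
      simp only [Complex.add_re, Complex.natCast_re]
      ring
    rw [norm_mul, norm_cpow_mul_gaussian _ ht, norm_div, norm_pow, norm_neg, Complex.norm_real,
      Complex.norm_natCast, Real.norm_eq_abs, hre, Real.rpow_add ht, Real.rpow_natCast, mul_pow]
    exact le_of_eq (by ring)
  · refine (integrableOn_rpow_mul_exp_sub_sq hs |x|).congr (Eventually.of_forall fun t => ?_)
    simp only [tsum_mul_left]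
    rw [(NormedSpace.expSeries_div_hasSum_exp (|x| * t)).tsum_eq, ← Real.exp_eq_exp_ℝ, mul_assoc,
      ← Real.exp_add]
    ring_nf
  · refine (ae_restrict_iff' measurableSet_Ioi).2 (Eventually.of_forall fun t ht => ?_)
    have ht0 : (t : ℂ) ≠ 0 := Complex.ofReal_ne_zero.2 (ne_of_gt ht)
    have hexp := (NormedSpace.expSeries_div_hasSum_exp (𝔸 := ℂ) (-x * t)).mul_left
      ((t : ℂ) ^ (s - 1) * Complex.exp (-(t : ℂ) ^ 2 / 2))
    rw [← Complex.exp_eq_exp_ℂ] at hexp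
    refine hexp.congr_fun fun k => ?_
    rw [show s + k - 1 = (s - 1) + k by ring, Complex.cpow_add _ _ ht0, Complex.cpow_natCast,
      mul_pow]
    ring

theorem integral_cpow_mul_gaussian_mul_exp {s : ℂ} (hs : 0 < s.re) (x : ℝ) :
    ∫ t : ℝ in Ioi 0, (t : ℂ) ^ (s - 1) * Complex.exp (-(t : ℂ) ^ 2 / 2) * Complex.exp (-x * t)
      = 1 / 2 * ((2 : ℂ) ^ (s / 2) * Complex.Gamma (s / 2)) * cylSeries (-s) 0 x
        - 1 / 2 * ((2 : ℂ) ^ ((s + 1) / 2) * Complex.Gamma ((s + 1) / 2)) *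
          cylSeries (-(s + 1)) 1 x := by
  have hsum := hasSum_integral_cpow_mul_gaussian_mul_exp hs x
  have hre (k : ℕ) : 0 < (s + k).re := by
    simpa using add_pos_of_pos_of_nonneg hs k.cast_nonneg
  simp_rw [fun k : ℕ => integral_cpow_mul_gaussian (hre k)] at hsum
  refine hsum.unique ?_
  rw [sub_eq_add_neg]
  refine HasSum.even_add_odd ?_ ?_
  · refine ((summable_cylSeries (-s) 0 x).hasSum.mul_left _).congr_fun fun k => ?_
    rw [show (s + ((2 * k : ℕ) : ℂ)) / 2 = s / 2 + k by push_cast; ring,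
      two_cpow_mul_Gamma_add_nat hs, (even_two_mul k).neg_pow, divPow, add_zero]
    ring
  · refine ((summable_cylSeries (-(s + 1)) 1 x).hasSum.mul_left _).neg.congr_fun fun k => ?_
    rw [show (s + ((2 * k + 1 : ℕ) : ℂ)) / 2 = (s + 1) / 2 + k by push_cast; ring,
      two_cpow_mul_Gamma_add_nat (by simpa using hre 1), (odd_two_mul_add_one k).neg_pow, divPow]
    ring

theorem Gamma_neg_mul_evenWeight {ν : ℂ} (hν : ν.re < 0) :
    Complex.Gamma (-ν) * evenWeight ν
      = 1 / 2 * ((2 : ℂ) ^ (-ν / 2) * Complex.Gamma (-ν / 2)) := by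
  have hduplication := Complex.Gamma_mul_Gamma_add_half (-ν / 2)
  have hGamma : Complex.Gamma (-ν / 2 + 1 / 2) ≠ 0 :=
    Complex.Gamma_ne_zero_of_re_pos (by simp; linarith)
  have hpow : (2 : ℂ) ^ (-ν / 2) * 2 ^ (1 - -ν) = 2 * 2 ^ (ν / 2) := by
    rw [← Complex.cpow_add _ _ two_ne_zero, show -ν / 2 + (1 - -ν) = ν / 2 + 1 by ring,
      Complex.cpow_add _ _ two_ne_zero, Complex.cpow_one, mul_comm]
  rw [show 2 * (-ν / 2) = -ν by ring] at hduplication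
  rw [evenWeight, mul_div_assoc', div_eq_iff hGamma, mul_assoc, mul_assoc, hduplication]
  linear_combination (-Complex.Gamma (-ν) * (√Real.pi : ℂ) / 2) * hpow

theorem Gamma_neg_mul_oddWeight {ν : ℂ} (hν : ν.re < 0) :
    Complex.Gamma (-ν) * oddWeight ν
      = 1 / 2 * ((2 : ℂ) ^ ((-ν + 1) / 2) * Complex.Gamma ((-ν + 1) / 2)) := by
  have hν0 : -ν ≠ 0 := fun h => hν.ne (by simp [neg_eq_zero.1 h])
  have h := Gamma_neg_mul_evenWeight (ν := ν - 1) (by simp; linarith)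
  rw [neg_sub', sub_neg_eq_add, Complex.Gamma_add_one _ hν0] at h
  rw [← h, oddWeight_eq_neg_mul_evenWeight]
  ring

theorem Gamma_neg_mul_parabolicD {ν : ℂ} (hν : ν.re < 0) (x : ℝ) :
    Complex.Gamma (-ν) * parabolicD ν x = Complex.exp (-(x : ℂ) ^ 2 / 4) *
      ∫ t : ℝ in Ioi 0, (t : ℂ) ^ (-ν - 1) * Complex.exp (-(t : ℂ) ^ 2 / 2) *
        Complex.exp (-x * t) := by
  rw [integral_cpow_mul_gaussian_mul_exp (by simpa using hν), parabolicD_eq, yEven_eq, yOdd_eq,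
    ← Gamma_neg_mul_evenWeight hν, ← Gamma_neg_mul_oddWeight hν, neg_add', neg_neg]
  ring

theorem parabolicD_isBigO_of_re_neg {ν : ℂ} (hν : ν.re < 0) :
    (fun x : ℝ => parabolicD ν x) =O[atTop] fun x : ℝ => Real.exp (-(1 / 4) * x ^ 2) := by
  have hs : 0 < (-ν).re := by simpa using hν
  have hGamma : 0 < ‖Complex.Gamma (-ν)‖ := norm_pos_iff.2 (Complex.Gamma_ne_zero_of_re_pos hs)
  have hbound (x : ℝ) (hx : 0 ≤ x) :
      ‖∫ t : ℝ in Ioi 0, (t : ℂ) ^ (-ν - 1) * Complex.exp (-(t : ℂ) ^ 2 / 2) *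
        Complex.exp (-x * t)‖
      ≤ ∫ t : ℝ in Ioi 0, t ^ ((-ν).re - 1) * Real.exp (0 * t - t ^ 2 / 2) := by
    refine norm_integral_le_of_norm_le (integrableOn_rpow_mul_exp_sub_sq hs 0) ?_
    refine (ae_restrict_iff' measurableSet_Ioi).2 (Eventually.of_forall fun t ht => ?_)
    have htpos : 0 < t := ht
    have hdecay : Real.exp (-(x * t)) ≤ 1 := Real.exp_le_one_iff.2 (by nlinarith)
    rw [norm_mul, norm_cpow_mul_gaussian _ ht, Complex.norm_exp, zero_mul, zero_sub, neg_div]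
    exact mul_le_of_le_one_right (mul_nonneg (Real.rpow_nonneg htpos.le _) (Real.exp_nonneg _))
      (by simpa using hdecay)
  refine IsBigO.of_bound ((∫ t : ℝ in Ioi 0, t ^ ((-ν).re - 1) * Real.exp (0 * t - t ^ 2 / 2)) /
    ‖Complex.Gamma (-ν)‖) ((eventually_ge_atTop 0).mono fun x hx => ?_)
  have hrepr := congrArg norm (Gamma_neg_mul_parabolicD hν x)
  have hre : (-(x : ℂ) ^ 2 / 4).re = -(1 / 4) * x ^ 2 := by
    norm_cast
    ring
  rw [norm_mul, norm_mul, Complex.norm_exp, hre] at hrepr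
  rw [Real.norm_of_nonneg (Real.exp_nonneg _), div_mul_eq_mul_div, le_div_iff₀ hGamma, mul_comm,
    hrepr, mul_comm]
  gcongr
  exact hbound x hx

end IntegralRepresentation

section Decay

theorem superpolynomialDecay_of_isBigO_exp_neg_mul_sq {u : ℝ → ℂ} {c : ℝ} (hc : 0 < c)
    (hu : u =O[atTop] fun x : ℝ => Real.exp (-c * x ^ 2)) :
    SuperpolynomialDecay atTop (fun x : ℝ => (x : ℂ)) u := by
  intro n
  have hpow : (fun x : ℝ => (x : ℂ) ^ n) =O[atTop] fun x : ℝ => x ^ (n : ℝ) := by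
    simp only [Real.rpow_natCast]
    exact .of_norm_left (by simpa using (isBigO_refl (fun x : ℝ => x ^ n) atTop).norm_left)
  have hgauss := rpow_mul_exp_neg_mul_sq_isLittleO_exp_neg hc (n : ℝ)
  refine ((hpow.mul hu).trans hgauss.isBigO).trans_tendsto ?_
  exact Real.tendsto_exp_atBot.comp (tendsto_id.const_mul_atTop_of_neg (by norm_num))

theorem superpolynomialDecay_parabolicD (ν : ℂ) :
    SuperpolynomialDecay atTop (fun x : ℝ => (x : ℂ)) fun x : ℝ => parabolicD ν x := by
  suffices h : ∀ (N : ℕ) (ν : ℂ), ν.re < N →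
      SuperpolynomialDecay atTop (fun x : ℝ => (x : ℂ)) fun x : ℝ => parabolicD ν x by
    obtain ⟨N, hN⟩ := exists_nat_gt ν.re
    exact h N ν hN
  intro N
  induction N with
  | zero =>
    intro ν hν
    exact superpolynomialDecay_of_isBigO_exp_neg_mul_sq (by norm_num)
      (parabolicD_isBigO_of_re_neg (by simpa using hν))
  | succ N ih =>
    intro ν hν
    push_cast at hν
    refine ((ih (ν - 1) (by simp; linarith)).param_mul.add
      ((ih (ν - 1 - 1) (by simp; linarith)).const_mul (-(ν - 1)))).congr fun x => ?_
    have hladder := parabolicD_add_one (ν - 1) x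
    rw [sub_add_cancel] at hladder
    simp only [Pi.add_apply, Pi.mul_apply, hladder]
    ring

end Decay

/-! ### Primitives -/

/-- `f` is a primitive of the locally integrable function `g`; a locally absolutely continuous
function is thus kept together with a choice of its almost everywhere defined derivative. -/
structure IsPrimitive (f g : ℝ → ℂ) : Prop where
  intervalIntegrable : ∀ s t, IntervalIntegrable g volume s t
  sub_eq : ∀ s t, f t - f s = ∫ x in s..t, g x

theorem absolutelyContinuousOnInterval_intervalIntegral {g : ℝ → ℂ}
    (hg : ∀ s t, IntervalIntegrable g volume s t) (s t : ℝ) :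
    AbsolutelyContinuousOnInterval (fun x => ∫ v in s..x, g v) s t := by
  have hre : ∀ s t, IntervalIntegrable (fun x => (g x).re) volume s t := fun s t =>
    ⟨(hg s t).1.re, (hg s t).2.re⟩
  have him : ∀ s t, IntervalIntegrable (fun x => (g x).im) volume s t := fun s t =>
    ⟨(hg s t).1.im, (hg s t).2.im⟩
  have hconst : ∀ c : ℂ, AbsolutelyContinuousOnInterval (fun _ : ℝ => c) s t := fun c =>
    contDiff_const.contDiffOn.absolutelyContinuousOnInterval
  convert! (((hre s t).absolutelyContinuousOnInterval_intervalIntegral left_mem_uIcc).fun_smul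
    (hconst 1)).fun_add (((him s t).absolutelyContinuousOnInterval_intervalIntegral
      left_mem_uIcc).fun_smul (hconst Complex.I)) using 2 with x
  rw [Complex.real_smul, Complex.real_smul, mul_one, ← intervalIntegral.integral_ofReal,
    ← intervalIntegral.integral_ofReal, ← intervalIntegral.integral_mul_const,
    ← intervalIntegral.integral_add]
  · simp only [Complex.re_add_im]
  · exact ⟨(hre s x).1.ofReal, (hre s x).2.ofReal⟩
  · exact IntervalIntegrable.mul_const ⟨(him s x).1.ofReal, (him s x).2.ofReal⟩ _

theorem isPrimitive_of_absolutelyContinuousOnInterval {f g : ℝ → ℂ}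
    (hf : ∀ s t, AbsolutelyContinuousOnInterval f s t)
    (hg : ∀ s t, IntervalIntegrable g volume s t) (hfg : ∀ᵐ x, HasDerivAt f (g x) x) :
    IsPrimitive f g := by
  refine ⟨hg, fun s t => ?_⟩
  obtain ⟨C, hC⟩ := ((hf s t).sub
    (absolutelyContinuousOnInterval_intervalIntegral hg s t)).const_of_ae_hasDerivAt_zero (by
      filter_upwards [hfg, (hg s t).ae_hasDerivAt_integral] with x hx hx' hmem
      simpa only [sub_self] using hx.sub (hx' hmem s left_mem_uIcc))
  have hs := hC s left_mem_uIcc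
  have ht := hC t right_mem_uIcc
  simp only [Pi.sub_apply, intervalIntegral.integral_same, sub_zero] at hs ht
  linear_combination ht - hs

namespace IsPrimitive

variable {f f₁ f₂ g g₁ g₂ : ℝ → ℂ}

theorem eq (h : IsPrimitive f g) (s t : ℝ) : f t = f s + ∫ x in s..t, g x := by
  rw [← h.sub_eq s t, add_sub_cancel]

theorem continuous (h : IsPrimitive f g) : Continuous f := by
  rw [show f = fun t => f 0 + ∫ x in (0 : ℝ)..t, g x from funext fun t => h.eq 0 t]
  exact continuous_const.add (intervalIntegral.continuous_primitive h.intervalIntegrable 0)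

theorem locallyIntegrable (h : IsPrimitive f g) : LocallyIntegrable g := fun x =>
  ⟨Ioc (x - 1) (x + 1), Ioc_mem_nhds (by linarith) (by linarith),
    (h.intervalIntegrable (x - 1) (x + 1)).1⟩

theorem absolutelyContinuousOnInterval (h : IsPrimitive f g) (s t : ℝ) :
    AbsolutelyContinuousOnInterval f s t := by
  rw [show f = fun x => f s + ∫ v in s..x, g v from funext fun x => h.eq s x]
  exact contDiff_const.contDiffOn.absolutelyContinuousOnInterval.fun_add
    (absolutelyContinuousOnInterval_intervalIntegral h.intervalIntegrable s t)

theorem ae_hasDerivAt (h : IsPrimitive f g) : ∀ᵐ x, HasDerivAt f (g x) x := by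
  filter_upwards [LocallyIntegrable.ae_hasDerivAt_integral h.locallyIntegrable] with x hx
  rw [show f = fun x => f 0 + ∫ v in (0 : ℝ)..x, g v from funext fun x => h.eq 0 x]
  exact (hx 0).const_add _

theorem of_hasDerivAt (hf : ∀ x, HasDerivAt f (g x) x) (hg : Continuous g) : IsPrimitive f g where
  intervalIntegrable := hg.intervalIntegrable
  sub_eq s t := (intervalIntegral.integral_eq_sub_of_hasDerivAt (fun x _ => hf x)
    (hg.intervalIntegrable s t)).symm

theorem add (h₁ : IsPrimitive f₁ g₁) (h₂ : IsPrimitive f₂ g₂) :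
    IsPrimitive (f₁ + f₂) (g₁ + g₂) where
  intervalIntegrable s t := (h₁.intervalIntegrable s t).add (h₂.intervalIntegrable s t)
  sub_eq s t := by
    simp only [Pi.add_apply]
    rw [intervalIntegral.integral_add (h₁.intervalIntegrable s t) (h₂.intervalIntegrable s t),
      ← h₁.sub_eq, ← h₂.sub_eq]
    ring

theorem const_smul (c : ℂ) (h : IsPrimitive f g) : IsPrimitive (c • f) (c • g) where
  intervalIntegrable s t := (h.intervalIntegrable s t).smul c
  sub_eq s t := by
    simp only [Pi.smul_apply]
    rw [intervalIntegral.integral_smul, ← h.sub_eq, smul_sub]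

theorem mul (h₁ : IsPrimitive f₁ g₁) (h₂ : IsPrimitive f₂ g₂) :
    IsPrimitive (fun x => f₁ x * f₂ x) (fun x => g₁ x * f₂ x + f₁ x * g₂ x) := by
  refine isPrimitive_of_absolutelyContinuousOnInterval
    (fun s t => (h₁.absolutelyContinuousOnInterval s t).fun_smul
      (h₂.absolutelyContinuousOnInterval s t))
    (fun s t => ((h₁.intervalIntegrable s t).mul_continuousOn h₂.continuous.continuousOn).add
      ((h₂.intervalIntegrable s t).continuousOn_mul h₁.continuous.continuousOn)) ?_
  filter_upwards [h₁.ae_hasDerivAt, h₂.ae_hasDerivAt] with x hx₁ hx₂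
  exact hx₁.mul hx₂

theorem indicator_Ioi (h : IsPrimitive f g) {p : ℝ} (hp : f p = 0) :
    IsPrimitive ((Ioi p).indicator f) ((Ioi p).indicator g) := by
  have hint : ∀ s t, IntervalIntegrable ((Ioi p).indicator g) volume s t := fun s t =>
    ⟨(h.intervalIntegrable s t).1.indicator measurableSet_Ioi,
      (h.intervalIntegrable s t).2.indicator measurableSet_Ioi⟩
  have hbase : ∀ t, (Ioi p).indicator f t = ∫ x in p..t, (Ioi p).indicator g x := fun t => by
    rcases le_or_gt t p with htp | hpt
    · rw [indicator_of_notMem (notMem_Ioi.2 htp), intervalIntegral.integral_symm,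
        intervalIntegral.integral_of_le htp, setIntegral_congr_fun measurableSet_Ioc
          fun x hx => indicator_of_notMem (notMem_Ioi.2 hx.2) g, integral_zero, neg_zero]
    · rw [indicator_of_mem (mem_Ioi.2 hpt), intervalIntegral.integral_of_le hpt.le,
        setIntegral_congr_fun measurableSet_Ioc
          fun x hx => indicator_of_mem (mem_Ioi.2 hx.1) g, ← intervalIntegral.integral_of_le hpt.le,
        ← h.sub_eq, hp, sub_zero]
  refine ⟨hint, fun s t => ?_⟩
  rw [hbase s, hbase t, intervalIntegral.integral_interval_sub_left (hint p t) (hint p s)]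

theorem integral_eq_sub_of_tendsto (h : IsPrimitive f g) (hg : Integrable g) {m n : ℂ}
    (hbot : Tendsto f atBot (𝓝 m)) (htop : Tendsto f atTop (𝓝 n)) : ∫ x, g x = n - m := by
  refine tendsto_nhds_unique
    (intervalIntegral_tendsto_integral hg tendsto_neg_atTop_atBot tendsto_id) ?_
  simp only [id, ← h.sub_eq]
  exact htop.sub (hbot.comp tendsto_neg_atTop_atBot)

theorem isWeakDeriv (h : IsPrimitive f g) : IsWeakDeriv f g := by
  intro φ hφ hφc
  have hd : Continuous (deriv φ) := hφ.continuous_deriv (by simp)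
  have hprod := (of_hasDerivAt (f := fun x => (φ x : ℂ)) (g := fun x => ((deriv φ x : ℝ) : ℂ))
    (fun x => (hφ.differentiable (by simp) x).hasDerivAt.ofReal_comp)
    (Complex.continuous_ofReal.comp hd)).mul h
  have hlim : Tendsto (fun x => (φ x : ℂ) * f x) (cocompact ℝ) (𝓝 0) :=
    ((hφc.comp_left Complex.ofReal_zero).mul_right (f' := f)).is_zero_at_infty
  have hdf : Integrable fun x => ((deriv φ x : ℝ) : ℂ) * f x := by
    simpa only [Complex.real_smul] using
      h.continuous.locallyIntegrable.integrable_smul_left_of_hasCompactSupport hd hφc.deriv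
  have hφg : Integrable fun x => (φ x : ℂ) * g x := by
    simpa only [Complex.real_smul] using
      h.locallyIntegrable.integrable_smul_left_of_hasCompactSupport hφ.continuous hφc
  rw [cocompact_eq_atBot_atTop, tendsto_sup] at hlim
  have hzero := hprod.integral_eq_sub_of_tendsto (hdf.add hφg) hlim.1 hlim.2
  rw [integral_add hdf hφg, sub_self] at hzero
  simpa only [Complex.real_smul] using eq_neg_of_add_eq_zero_left hzero

end IsPrimitive

theorem IsPrimitive.conj {f g : ℝ → ℂ} (h : IsPrimitive f g) :
    IsPrimitive (fun x => conj (f x)) (fun x => conj (g x)) where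
  intervalIntegrable s t := ⟨Complex.conjLIE.integrable_comp_iff.2 (h.intervalIntegrable s t).1,
    Complex.conjLIE.integrable_comp_iff.2 (h.intervalIntegrable s t).2⟩
  sub_eq s t := by
    rw [← map_sub, h.sub_eq, intervalIntegral, intervalIntegral, map_sub, integral_conj,
      integral_conj]

/-! ### Weak derivatives -/

theorem exists_contDiff_hasCompactSupport_deriv_eq {ψ : ℝ → ℝ} (hψ : ContDiff ℝ ∞ ψ)
    (hψc : HasCompactSupport ψ) (hψ0 : ∫ x, ψ x = 0) :
    ∃ φ : ℝ → ℝ, ContDiff ℝ ∞ φ ∧ HasCompactSupport φ ∧ deriv φ = ψ := by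
  obtain ⟨A, hA⟩ := hψc.isCompact.isBounded.subset_closedBall 0
  rw [Real.closedBall_eq_Icc, zero_sub, zero_add] at hA
  have hout : ∀ x ∉ Icc (-A) A, ψ x = 0 := fun x hx =>
    image_eq_zero_of_notMem_tsupport fun hmem => hx (hA hmem)
  have hderiv : ∀ x, HasDerivAt (fun x => ∫ t in (-A)..x, ψ t) (ψ x) x := fun x =>
    intervalIntegral.integral_hasDerivAt_right (hψ.continuous.intervalIntegrable _ _)
      hψ.continuous.stronglyMeasurable.stronglyMeasurableAtFilter hψ.continuous.continuousAt
  have hderiv_eq : deriv (fun x => ∫ t in (-A)..x, ψ t) = ψ := funext fun x => (hderiv x).deriv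
  refine ⟨fun x => ∫ t in (-A)..x, ψ t, ?_, ?_, hderiv_eq⟩
  · rw [contDiff_infty_iff_deriv, hderiv_eq]
    exact ⟨fun x => (hderiv x).differentiableAt, hψ⟩
  · refine HasCompactSupport.intro (isCompact_Icc (a := -A) (b := A)) fun x hx => ?_
    rcases lt_or_ge x (-A) with hlt | hge
    · rw [intervalIntegral.integral_symm, intervalIntegral.integral_of_le hlt.le,
        integral_Ioc_eq_integral_Ioo,
        setIntegral_congr_fun measurableSet_Ioo fun y hy => hout y fun hmem => by
          linarith [hmem.1, hy.2], integral_zero, neg_zero]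
    · have hAx : A < x := lt_of_not_ge fun hle => hx ⟨hge, hle⟩
      rw [← hψ0, intervalIntegral.integral_of_le hge, ← integral_Icc_eq_integral_Ioc]
      exact setIntegral_eq_integral_of_forall_compl_eq_zero fun y hy =>
        hout y fun hmem => hy ⟨hmem.1, hmem.2.trans hAx.le⟩

theorem exists_ae_eq_const_of_isWeakDeriv_zero {h : ℝ → ℂ} (hh : LocallyIntegrable h)
    (h0 : IsWeakDeriv h 0) : ∃ c : ℂ, ∀ᵐ x, h x = c := by
  let B : ContDiffBump (0 : ℝ) := ⟨1, 2, one_pos, one_lt_two⟩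
  set ρ : ℝ → ℝ := B.normed volume
  have hρ : ContDiff ℝ ∞ ρ := B.contDiff_normed
  have hρc : HasCompactSupport ρ := B.hasCompactSupport_normed
  have hint : ∀ φ : ℝ → ℝ, ContDiff ℝ ∞ φ → HasCompactSupport φ → Integrable fun x => φ x • h x :=
    fun φ hφ hc => hh.integrable_smul_left_of_hasCompactSupport hφ.continuous hc
  suffices hsub : ∀ᵐ x, h x - ∫ y, ρ y • h y = 0 from
    ⟨_, hsub.mono fun x hx => sub_eq_zero.1 hx⟩
  refine ae_eq_zero_of_integral_contDiff_smul_eq_zero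
    (hh.sub (locallyIntegrable_const _)) fun φ hφ hφc => ?_
  have hφi : Integrable φ := hφ.continuous.integrable_of_hasCompactSupport hφc
  have hρi : Integrable ρ := hρ.continuous.integrable_of_hasCompactSupport hρc
  -- `φ - (∫ φ) ρ` has integral zero, so it is the derivative of a test function
  obtain ⟨Φ, hΦ, hΦc, hΦφ⟩ := exists_contDiff_hasCompactSupport_deriv_eq
    (ψ := fun x => φ x - (∫ y, φ y) * ρ x) (hφ.sub (contDiff_const.mul hρ))
    (hφc.sub hρc.mul_left) (by
      rw [integral_sub hφi (hρi.const_mul _), integral_const_mul, B.integral_normed, mul_one,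
        sub_self])
  have hΦ0 := h0 Φ hΦ hΦc
  have hρs : Integrable fun x => (∫ y, φ y) • ρ x • h x := (hint ρ hρ hρc).smul (∫ y, φ y)
  simp only [hΦφ, sub_smul, mul_smul, Pi.zero_apply, smul_zero, integral_zero, neg_zero] at hΦ0
  rw [integral_sub (hint φ hφ hφc) hρs, integral_smul] at hΦ0
  simp only [smul_sub]
  rw [integral_sub (hint φ hφ hφc) (hφi.smul_const _), integral_smul_const, hΦ0]

theorem isPrimitive_integral {g : ℝ → ℂ} (hg : ∀ s t, IntervalIntegrable g volume s t) (c : ℂ) :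
    IsPrimitive (fun t => c + ∫ x in (0 : ℝ)..t, g x) g :=
  ⟨hg, fun s t => by
    rw [add_sub_add_left_eq_sub, intervalIntegral.integral_interval_sub_left (hg 0 t) (hg 0 s)]⟩

theorem IsWeakDeriv.exists_isPrimitive {f g : ℝ → ℂ} (hf : MemLp f 2) (hg : MemLp g 2)
    (h : IsWeakDeriv f g) : ∃ F : ℝ → ℂ, f =ᵐ[volume] F ∧ IsPrimitive F g := by
  have hgi : ∀ s t, IntervalIntegrable g volume s t := fun s t =>
    (intervalIntegrable_iff' (by finiteness)).2
      ((hg.locallyIntegrable one_le_two).integrableOn_isCompact isCompact_uIcc)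
  have hP := isPrimitive_integral hgi 0
  obtain ⟨c, hc⟩ := exists_ae_eq_const_of_isWeakDeriv_zero
    (h := fun t => f t - (0 + ∫ x in (0 : ℝ)..t, g x))
    ((hf.locallyIntegrable one_le_two).sub hP.continuous.locallyIntegrable) fun φ hφ hφc => by
      have hd : Continuous (deriv φ) := hφ.continuous_deriv (by simp)
      simp only [smul_sub]
      rw [integral_sub (integrable_test_smul hf hd hφc.deriv)
        (hP.continuous.locallyIntegrable.integrable_smul_left_of_hasCompactSupport hd hφc.deriv),
        h φ hφ hφc, hP.isWeakDeriv φ hφ hφc]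
      simp
  exact ⟨_, hc.mono fun t ht => by linear_combination ht, isPrimitive_integral hgi c⟩

theorem isPrimitive_weakDeriv {f : ℝ → ℂ} (hf : f ∈ formDomain) :
    IsPrimitive f (weakDeriv f) := by
  obtain ⟨hcont, hf2, hd, -⟩ := hf
  obtain ⟨hd2, hw⟩ := weakDeriv_spec hd
  obtain ⟨F, hF, hP⟩ := hw.exists_isPrimitive hf2 hd2
  rwa [(hcont.ae_eq_iff_eq volume hP.continuous).1 hF] at hP ⊢

theorem conj_mem_formDomain {f : ℝ → ℂ} (hf : f ∈ formDomain) :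
    (fun x => conj (f x)) ∈ formDomain := by
  have hw := (isPrimitive_weakDeriv hf).conj.isWeakDeriv
  obtain ⟨hcont, hf2, hd, hx⟩ := hf
  refine ⟨Complex.continuous_conj.comp hcont, hf2.star, ⟨_, (weakDeriv_spec hd).1.star, hw⟩, ?_⟩
  convert! hx.star using 2 with x
  simp

theorem weakDeriv_conj {f : ℝ → ℂ} (hf : f ∈ formDomain) :
    weakDeriv (fun x => conj (f x)) =ᵐ[volume] fun x => conj (weakDeriv f x) :=
  weakDeriv_ae_eq (weakDeriv_spec hf.2.2.1).1.star (isPrimitive_weakDeriv hf).conj.isWeakDeriv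

/-! ### Growth and decay -/

theorem norm_intervalIntegral_le (g : L2) {s t : ℝ} (hst : s ≤ t) :
    ‖∫ x in s..t, g x‖ ≤ √(t - s) * ‖g‖ := by
  rw [intervalIntegral.integral_of_le hst,
    ← L2.inner_indicatorConstLp_one (𝕜 := ℂ) measurableSet_Ioc (by simp) g]
  refine (norm_inner_le_norm _ _).trans_eq ?_
  rw [norm_indicatorConstLp (by norm_num) (by norm_num)]
  simp [Real.sqrt_eq_rpow, measureReal_def, ENNReal.toReal_ofReal (sub_nonneg.2 hst)]

theorem IsPrimitive.norm_sub_le {f g : ℝ → ℂ} (h : IsPrimitive f g) (hg : MemLp g 2) (s t : ℝ) :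
    ‖f t - f s‖ ≤ √|t - s| * ‖hg.toLp g‖ := by
  wlog hst : s ≤ t generalizing s t
  · rw [norm_sub_rev, abs_sub_comm]
    exact this t s (le_of_not_ge hst)
  rw [abs_of_nonneg (sub_nonneg.2 hst), h.sub_eq s t]
  convert norm_intervalIntegral_le (hg.toLp g) hst using 2
  refine intervalIntegral.integral_congr_ae ?_
  filter_upwards [hg.coeFn_toLp] with x hx _ using hx.symm

theorem IsPrimitive.isBigO_id {f g : ℝ → ℂ} (h : IsPrimitive f g) (hg : MemLp g 2) :
    f =O[cocompact ℝ] fun x : ℝ => (x : ℂ) := by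
  refine IsBigO.of_bound (‖f 0‖ + ‖hg.toLp g‖) ?_
  filter_upwards [(tendsto_norm_cocompact_atTop (E := ℝ)).eventually_ge_atTop 1] with t ht
  rw [Real.norm_eq_abs] at ht
  have hsub := h.norm_sub_le hg 0 t
  rw [sub_zero] at hsub
  have hsqrt : √|t| ≤ |t| := Real.sqrt_le_iff.2 ⟨abs_nonneg t, by nlinarith⟩
  rw [Complex.norm_real, Real.norm_eq_abs]
  calc ‖f t‖ ≤ ‖f 0‖ + ‖f t - f 0‖ := by simpa using norm_add_le (f 0) (f t - f 0)
    _ ≤ ‖f 0‖ * |t| + |t| * ‖hg.toLp g‖ :=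
      add_le_add (le_mul_of_one_le_right (norm_nonneg _) ht) (hsub.trans (by gcongr))
    _ = (‖f 0‖ + ‖hg.toLp g‖) * |t| := by ring

theorem tendsto_mul_of_isBigO_of_superpolynomialDecay {l : Filter ℝ} {f u : ℝ → ℂ}
    (hf : f =O[l] fun x : ℝ => (x : ℂ))
    (hu : SuperpolynomialDecay l (fun x : ℝ => (x : ℂ)) u) :
    Tendsto (fun x => f x * u x) l (𝓝 0) :=
  (hf.mul (isBigO_refl u l)).trans_tendsto (by simpa only [pow_one] using hu 1)

theorem memLp_two_of_superpolynomialDecay {F : ℝ → ℂ} (hm : AEStronglyMeasurable F volume)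
    (hloc : ∀ K, IsCompact K → ∃ C, ∀ x ∈ K, ‖F x‖ ≤ C)
    (hF : SuperpolynomialDecay (cocompact ℝ) (fun x : ℝ => (x : ℂ)) F) : MemLp F 2 := by
  refine (memLp_two_iff_integrable_sq_norm hm).2
    (LocallyIntegrable.integrable_of_isBigO_cocompact (g := fun x : ℝ => (1 + x ^ 2)⁻¹) ?_ ?_
      (integrable_inv_one_add_sq.integrableAtFilter _))
  · refine locallyIntegrable_iff.2 fun K hK => ?_
    obtain ⟨C, hC⟩ := hloc K hK
    refine Measure.integrableOn_of_bounded hK.measure_ne_top (hm.norm.pow 2) (M := C ^ 2)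
      (ae_restrict_of_forall_mem hK.measurableSet fun x hx => ?_)
    rw [Real.norm_of_nonneg (by positivity)]
    exact pow_le_pow_left₀ (norm_nonneg _) (hC x hx) 2
  · refine IsBigO.of_bound 1 ?_
    have h0 := (hF 0).norm.eventually_le_const (u := 1 / 2) (by norm_num)
    have h1 := (hF 1).norm.eventually_le_const (u := 1 / 2) (by norm_num)
    filter_upwards [h0, h1] with x hx0 hx1
    rw [pow_zero, one_mul] at hx0
    rw [pow_one, norm_mul, Complex.norm_real, Real.norm_eq_abs] at hx1
    rw [Real.norm_of_nonneg (by positivity), Real.norm_of_nonneg (by positivity), one_mul,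
      ← one_div, le_div_iff₀ (by positivity)]
    nlinarith [norm_nonneg (F x), mul_nonneg (abs_nonneg x) (norm_nonneg (F x)), sq_abs x]

/-! ### Solutions with jumps -/

/-- The step function `∑ p, J p • v p • 1_{(p, ∞)}` of a finitely supported family `J` of jumps
with weight `v`; with `v = 1` it is the singular part of the derivative of a function whose
derivative jumps by `J p` at `p`. -/
def jumpStep (v : ℝ → ℂ) (J : ℝ →₀ ℂ) : ℝ → ℂ :=
  Finsupp.linearCombination ℂ (fun p => (Ioi p).indicator fun _ => v p) J

theorem jumpStep_single (v : ℝ → ℂ) (p : ℝ) (c : ℂ) :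
    jumpStep v (Finsupp.single p c) = c • (Ioi p).indicator fun _ => v p :=
  Finsupp.linearCombination_single ..

theorem jumpStep_eventuallyEq_atBot (v : ℝ → ℂ) (J : ℝ →₀ ℂ) :
    jumpStep v J =ᶠ[atBot] fun _ => 0 := by
  induction J using Finsupp.induction_linear with
  | zero => rw [jumpStep, map_zero]; rfl
  | add J K hJ hK =>
    filter_upwards [hJ, hK] with x hJx hKx
    rw [jumpStep, map_add, Pi.add_apply, ← jumpStep, ← jumpStep, hJx, hKx, add_zero]
  | single p c =>
    filter_upwards [eventually_le_atBot p] with x hx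
    rw [jumpStep_single, Pi.smul_apply, indicator_of_notMem (notMem_Ioi.2 hx), smul_zero]

theorem jumpStep_eventuallyEq_atTop (v : ℝ → ℂ) (J : ℝ →₀ ℂ) :
    jumpStep v J =ᶠ[atTop] fun _ => Finsupp.linearCombination ℂ v J := by
  induction J using Finsupp.induction_linear with
  | zero => simp only [jumpStep, map_zero]; rfl
  | add J K hJ hK =>
    simp only [jumpStep, map_add]
    exact hJ.add hK
  | single p c =>
    filter_upwards [eventually_gt_atTop p] with x hx
    rw [jumpStep_single, Pi.smul_apply, indicator_of_mem (mem_Ioi.2 hx),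
      Finsupp.linearCombination_single]

theorem IsPrimitive.jumpStep_mul_sub {v v' : ℝ → ℂ} (h : IsPrimitive v v') (J : ℝ →₀ ℂ) :
    IsPrimitive (fun x => jumpStep 1 J x * v x - jumpStep v J x)
      (fun x => jumpStep 1 J x * v' x) := by
  induction J using Finsupp.induction_linear with
  | zero =>
    simp only [jumpStep, map_zero, Pi.zero_apply, zero_mul, sub_zero]
    exact .of_hasDerivAt (fun x => hasDerivAt_const x 0) continuous_const
  | add J K hJ hK =>
    convert hJ.add hK using 1 <;> funext x <;>
      simp only [jumpStep, map_add, Pi.add_apply] <;> ring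
  | single p c =>
    have hvp : IsPrimitive (fun x => v x + -v p) (fun x => v' x + 0) :=
      h.add (.of_hasDerivAt (fun x => hasDerivAt_const x (-v p)) continuous_const)
    convert (hvp.indicator_Ioi (p := p) (add_neg_cancel _)).const_smul c using 1 <;> funext x <;>
      rcases le_or_gt x p with hxp | hxp
    all_goals
      simp only [jumpStep_single, Pi.smul_apply, smul_eq_mul, indicator, mem_Ioi, hxp, hxp.not_gt,
        if_true, if_false, Pi.one_apply]
      ring

/-- `u`, with derivative `u'`, is a weak solution of `-u'' + (x²/4 - 1/2) u = ν u` on the real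
line except for jumps of `u'`, of height `J p` at each point `p`. The choice `J = 0` gives the
classical solutions. -/
structure IsJumpSolution (ν : ℂ) (J : ℝ →₀ ℂ) (u u' : ℝ → ℂ) : Prop where
  isPrimitive : IsPrimitive u u'
  isPrimitive_sub_jumpStep :
    IsPrimitive (u' - jumpStep 1 J) fun x => ((x : ℂ) ^ 2 / 4 - 1 / 2 - ν) * u x

/-- The Wronskian `u v' - u' v`. -/
def wronskian (u u' v v' : ℝ → ℂ) (x : ℝ) : ℂ :=
  u x * v' x - u' x * v x

namespace IsJumpSolution

variable {ν : ℂ} {J K : ℝ →₀ ℂ} {u u' v v' : ℝ → ℂ}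

theorem add (hu : IsJumpSolution ν J u u') (hv : IsJumpSolution ν K v v') :
    IsJumpSolution ν (J + K) (u + v) (u' + v') where
  isPrimitive := hu.isPrimitive.add hv.isPrimitive
  isPrimitive_sub_jumpStep := by
    convert hu.isPrimitive_sub_jumpStep.add hv.isPrimitive_sub_jumpStep using 1
    · simp only [jumpStep, map_add]
      abel
    · funext x
      simp only [Pi.add_apply]
      ring

theorem const_smul (c : ℂ) (hu : IsJumpSolution ν J u u') :
    IsJumpSolution ν (c • J) (c • u) (c • u') where
  isPrimitive := hu.isPrimitive.const_smul c
  isPrimitive_sub_jumpStep := by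
    convert hu.isPrimitive_sub_jumpStep.const_smul c using 1
    · simp only [jumpStep, map_smul, smul_sub]
    · funext x
      simp only [Pi.smul_apply, smul_eq_mul]
      ring

theorem of_hasDerivAt (hu : ∀ x, HasDerivAt u (u' x) x)
    (hu' : ∀ x : ℝ, HasDerivAt u' (((x : ℂ) ^ 2 / 4 - 1 / 2 - ν) * u x) x) :
    IsJumpSolution ν 0 u u' where
  isPrimitive := .of_hasDerivAt hu (continuous_iff_continuousAt.2 fun x => (hu' x).continuousAt)
  isPrimitive_sub_jumpStep := by
    have hcont : Continuous u := continuous_iff_continuousAt.2 fun x => (hu x).continuousAt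
    rw [jumpStep, map_zero, sub_zero]
    exact .of_hasDerivAt hu' (by fun_prop)

theorem isPrimitive_deriv (hu : IsJumpSolution ν 0 u u') :
    IsPrimitive u' fun x => ((x : ℂ) ^ 2 / 4 - 1 / 2 - ν) * u x := by
  simpa only [jumpStep, map_zero, sub_zero] using hu.isPrimitive_sub_jumpStep

theorem isPrimitive_mul_sub_jumpStep {f f' : ℝ → ℂ} (hu : IsJumpSolution ν J u u')
    (hf : IsPrimitive f f') :
    IsPrimitive (fun x => f x * u' x - jumpStep f J x)
      (fun x => f' x * u' x + f x * (((x : ℂ) ^ 2 / 4 - 1 / 2 - ν) * u x)) := by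
  convert (hf.mul hu.isPrimitive_sub_jumpStep).add (hf.jumpStep_mul_sub J) using 1 <;>
    funext x <;> simp only [Pi.add_apply, Pi.sub_apply] <;> ring

theorem exists_wronskian_add_jumpStep_eq (hu : IsJumpSolution ν J u u')
    (hv : IsJumpSolution ν 0 v v') :
    ∃ c, ∀ x, wronskian u u' v v' x + jumpStep v J x = c := by
  have hconst : IsPrimitive (fun x => wronskian u u' v v' x + jumpStep v J x) 0 := by
    convert (hu.isPrimitive.mul hv.isPrimitive_deriv).add
      ((hu.isPrimitive_mul_sub_jumpStep hv.isPrimitive).const_smul (-1)) using 1 <;>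
      funext x <;>
      simp only [wronskian, Pi.add_apply, Pi.smul_apply, smul_eq_mul, Pi.zero_apply] <;> ring
  exact ⟨_, fun x => by
    simpa only [Pi.zero_apply, intervalIntegral.integral_zero, add_zero] using hconst.eq 0 x⟩

theorem wronskian_eq (hu : IsJumpSolution ν 0 u u') (hv : IsJumpSolution ν 0 v v') (x y : ℝ) :
    wronskian u u' v v' x = wronskian u u' v v' y := by
  obtain ⟨c, hc⟩ := hu.exists_wronskian_add_jumpStep_eq hv
  simp only [jumpStep, map_zero, Pi.zero_apply, add_zero] at hc
  rw [hc x, hc y]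

theorem exists_wronskian_eventuallyEq (hu : IsJumpSolution ν J u u')
    (hv : IsJumpSolution ν 0 v v') :
    ∃ w, (∀ᶠ x in atBot, wronskian u u' v v' x = w) ∧
      ∀ᶠ x in atTop, wronskian u u' v v' x = w - Finsupp.linearCombination ℂ v J := by
  obtain ⟨w, hw⟩ := hu.exists_wronskian_add_jumpStep_eq hv
  refine ⟨w, ?_, ?_⟩
  · filter_upwards [jumpStep_eventuallyEq_atBot v J] with x hJx
    rw [← hw x, hJx, add_zero]
  · filter_upwards [jumpStep_eventuallyEq_atTop v J] with x hJx
    rw [← hw x, hJx, add_sub_cancel_right]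

end IsJumpSolution

/-! ### Classical solutions -/

/-- The classical solution of `-u'' + (x²/4 - 1/2) u = ν u` with `u(0) = α` and `u'(0) = β`. -/
def cauchySol (ν α β : ℂ) (x : ℝ) : ℂ := α * yEven ν x + β * yOdd ν x

theorem hasDerivAt_deriv_yEven (ν x : ℂ) :
    HasDerivAt (deriv (yEven ν)) ((x ^ 2 / 4 - 1 / 2 - ν) * yEven ν x) x := by
  rw [funext fun y => (hasDerivAt_yEven ν y).deriv]
  refine ((((hasDerivAt_id x).div_const 2).neg.mul (hasDerivAt_yEven ν x)).sub
    ((hasDerivAt_yOdd (ν - 1) x).const_mul ν)).congr_deriv ?_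
  simp only [id_eq, Pi.neg_apply]
  have hmul := mul_yOdd (ν - 1) x
  rw [sub_add_cancel] at hmul
  linear_combination ν * hmul

theorem hasDerivAt_deriv_yOdd (ν x : ℂ) :
    HasDerivAt (deriv (yOdd ν)) ((x ^ 2 / 4 - 1 / 2 - ν) * yOdd ν x) x := by
  rw [funext fun y => (hasDerivAt_yOdd ν y).deriv]
  refine ((((hasDerivAt_id x).div_const 2).neg.mul (hasDerivAt_yOdd ν x)).add
    (hasDerivAt_yEven (ν - 1) x)).congr_deriv ?_
  simp only [id_eq, Pi.neg_apply]
  have hmul := mul_yEven (ν - 1) x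
  rw [sub_add_cancel] at hmul
  linear_combination -hmul

theorem hasDerivAt_cauchySol (ν α β : ℂ) (x : ℝ) :
    HasDerivAt (cauchySol ν α β) (α * deriv (yEven ν) x + β * deriv (yOdd ν) x) x :=
  ((hasDerivAt_yEven ν x).differentiableAt.hasDerivAt.comp_ofReal.const_mul α).add
    ((hasDerivAt_yOdd ν x).differentiableAt.hasDerivAt.comp_ofReal.const_mul β)

theorem isJumpSolution_cauchySol (ν α β : ℂ) :
    IsJumpSolution ν 0 (cauchySol ν α β) (deriv (cauchySol ν α β)) := by
  refine .of_hasDerivAt (fun x => (hasDerivAt_cauchySol ν α β x).differentiableAt.hasDerivAt)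
    fun x => ?_
  rw [funext fun y => (hasDerivAt_cauchySol ν α β y).deriv]
  refine (((hasDerivAt_deriv_yEven ν x).comp_ofReal.const_mul α).add
    ((hasDerivAt_deriv_yOdd ν x).comp_ofReal.const_mul β)).congr_deriv ?_
  simp only [cauchySol]
  ring

theorem cauchySol_zero (ν α β : ℂ) : cauchySol ν α β 0 = α := by
  simp [cauchySol, yEven_zero_right, yOdd_zero_right]

theorem deriv_cauchySol_zero (ν α β : ℂ) : deriv (cauchySol ν α β) 0 = β := by
  rw [(hasDerivAt_cauchySol ν α β 0).deriv, Complex.ofReal_zero, (hasDerivAt_yEven ν 0).deriv,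
    (hasDerivAt_yOdd ν 0).deriv]
  simp [yEven_zero_right, yOdd_zero_right]

theorem cauchySol_smul (ν c α β : ℂ) : cauchySol ν (c * α) (c * β) = c • cauchySol ν α β := by
  funext x
  simp only [cauchySol, Pi.smul_apply, smul_eq_mul]
  ring

theorem wronskian_cauchySol (ν α β γ δ : ℂ) (x : ℝ) :
    wronskian (cauchySol ν α β) (deriv (cauchySol ν α β)) (cauchySol ν γ δ)
      (deriv (cauchySol ν γ δ)) x = α * δ - β * γ := by
  rw [(isJumpSolution_cauchySol ν α β).wronskian_eq (isJumpSolution_cauchySol ν γ δ) x 0, wronskian]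
  simp only [cauchySol_zero, deriv_cauchySol_zero]

theorem IsJumpSolution.exists_eventuallyEq_cauchySol {ν : ℂ} {J : ℝ →₀ ℂ} {u u' : ℝ → ℂ}
    (hu : IsJumpSolution ν J u u') :
    ∃ α β, u =ᶠ[atTop] cauchySol ν α β ∧ u' =ᶠ[atTop] deriv (cauchySol ν α β) := by
  have hconst (γ δ : ℂ) : ∃ w, ∀ᶠ x in atTop,
      wronskian u u' (cauchySol ν γ δ) (deriv (cauchySol ν γ δ)) x = w :=
    let ⟨_, _, hw⟩ := hu.exists_wronskian_eventuallyEq (isJumpSolution_cauchySol ν γ δ)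
    ⟨_, hw⟩
  obtain ⟨α, hα⟩ := hconst 0 1
  obtain ⟨β, hβ⟩ := hconst 1 0
  refine ⟨α, -β, ?_, ?_⟩
  all_goals
    filter_upwards [hα, hβ] with x hαx hβx
    have hW := wronskian_cauchySol ν 1 0 0 1 x
    rw [← hαx, ← hβx]
    simp only [wronskian, (hasDerivAt_cauchySol ν _ _ x).deriv, cauchySol] at hW ⊢
  · linear_combination -u x * hW
  · linear_combination -u' x * hW

theorem parabolicD_eq_cauchySol (ν : ℂ) :
    (fun x : ℝ => parabolicD ν x) = cauchySol ν (evenWeight ν) (-oddWeight ν) := by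
  funext x
  rw [parabolicD_eq, cauchySol]
  ring

theorem parabolicD_neg_eq_cauchySol (ν : ℂ) :
    (fun x : ℝ => parabolicD ν (-x)) = cauchySol ν (evenWeight ν) (oddWeight ν) := by
  funext x
  rw [parabolicD_eq, cauchySol, yEven_neg, yOdd_neg]
  ring

theorem superpolynomialDecay_deriv_parabolicD (ν : ℂ) :
    SuperpolynomialDecay atTop (fun x : ℝ => (x : ℂ)) (deriv fun x : ℝ => parabolicD ν x) := by
  rw [funext fun x : ℝ => (hasDerivAt_parabolicD ν x).comp_ofReal.deriv]
  convert (((superpolynomialDecay_parabolicD ν).param_mul).const_mul (-1 / 2)).add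
    ((superpolynomialDecay_parabolicD (ν - 1)).const_mul ν) using 1
  funext x
  simp only [Pi.add_apply, Pi.mul_apply]
  ring

theorem superpolynomialDecay_comp_neg {f : ℝ → ℂ}
    (hf : SuperpolynomialDecay atTop (fun x : ℝ => (x : ℂ)) f) :
    SuperpolynomialDecay atBot (fun x : ℝ => (x : ℂ)) fun x => f (-x) := fun n => by
  have h := ((hf n).comp tendsto_neg_atBot_atTop).const_mul ((-1) ^ n)
  rw [mul_zero] at h
  refine h.congr fun x => ?_
  simp only [Function.comp_apply, Complex.ofReal_neg, ← mul_assoc, ← mul_pow, neg_one_mul, neg_neg]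

theorem superpolynomialDecay_parabolicD_neg (ν : ℂ) :
    SuperpolynomialDecay atBot (fun x : ℝ => (x : ℂ)) fun x : ℝ => parabolicD ν (-x) := by
  simpa only [Complex.ofReal_neg] using
    superpolynomialDecay_comp_neg (superpolynomialDecay_parabolicD ν)

theorem superpolynomialDecay_deriv_parabolicD_neg (ν : ℂ) :
    SuperpolynomialDecay atBot (fun x : ℝ => (x : ℂ))
      (deriv fun x : ℝ => parabolicD ν (-x)) := by
  have hderiv : (deriv fun x : ℝ => parabolicD ν (-x)) =
      fun x => -deriv (fun x : ℝ => parabolicD ν x) (-x) := by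
    funext x
    simpa only [Complex.ofReal_neg] using deriv_comp_neg (fun x : ℝ => parabolicD ν x) x
  rw [hderiv]
  simpa only [neg_one_mul] using
    (superpolynomialDecay_comp_neg (superpolynomialDecay_deriv_parabolicD ν)).const_mul (-1)

/-- A solution with jumps that decays rapidly at `±∞`, together with its derivative. -/
structure IsDecayingSolution (ν : ℂ) (J : ℝ →₀ ℂ) (u u' : ℝ → ℂ) : Prop
    extends IsJumpSolution ν J u u' where
  superpolynomialDecay :
    SuperpolynomialDecay (cocompact ℝ) (fun x : ℝ => (x : ℂ)) u
  superpolynomialDecay_deriv :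
    SuperpolynomialDecay (cocompact ℝ) (fun x : ℝ => (x : ℂ)) u'

theorem IsJumpSolution.exists_eventuallyEq_smul_parabolicD {ν : ℂ} {J : ℝ →₀ ℂ} {u u' : ℝ → ℂ}
    (hu : IsJumpSolution ν J u u')
    (hW : ∀ᶠ x in atTop, wronskian u u' (fun x : ℝ => parabolicD ν x)
      (deriv fun x : ℝ => parabolicD ν x) x = 0) :
    ∃ c : ℂ, u =ᶠ[atTop] c • (fun x : ℝ => parabolicD ν x) ∧
      u' =ᶠ[atTop] c • deriv fun x : ℝ => parabolicD ν x := by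
  obtain ⟨α, β, hα, hβ⟩ := hu.exists_eventuallyEq_cauchySol
  simp only [parabolicD_eq_cauchySol] at hW ⊢
  have hdet : α * -oddWeight ν - β * evenWeight ν = 0 := by
    obtain ⟨x, hWx, hαx, hβx⟩ := (hW.and (hα.and hβ)).exists
    rw [← wronskian_cauchySol ν α β (evenWeight ν) (-oddWeight ν) x, ← hWx]
    simp only [wronskian, hαx, hβx]
  obtain ⟨c, rfl, rfl⟩ : ∃ c, α = c * evenWeight ν ∧ β = c * -oddWeight ν := by
    rcases evenWeight_ne_zero_or_oddWeight_ne_zero ν with h | h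
    · refine ⟨α / evenWeight ν, by field_simp, ?_⟩
      field_simp
      linear_combination -hdet
    · refine ⟨-β / oddWeight ν, ?_, by field_simp⟩
      field_simp
      linear_combination -hdet
  have hsmul := cauchySol_smul ν c (evenWeight ν) (-oddWeight ν)
  refine ⟨c, hsmul ▸ hα, hβ.trans (.of_eq ?_)⟩
  rw [hsmul]
  exact funext fun x => deriv_const_smul c (hasDerivAt_cauchySol ν _ _ x).differentiableAt

theorem IsJumpSolution.isDecayingSolution {ν c : ℂ} {J : ℝ →₀ ℂ} {u u' : ℝ → ℂ}
    (hu : IsJumpSolution ν J u u')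
    (hbot : u =ᶠ[atBot] c • fun x : ℝ => parabolicD ν (-x))
    (hbot' : u' =ᶠ[atBot] c • deriv fun x : ℝ => parabolicD ν (-x))
    (hW : ∀ᶠ x in atTop, wronskian u u' (fun x : ℝ => parabolicD ν x)
      (deriv fun x : ℝ => parabolicD ν x) x = 0) :
    IsDecayingSolution ν J u u' := by
  obtain ⟨d, htop, htop'⟩ := hu.exists_eventuallyEq_smul_parabolicD hW
  refine ⟨hu, fun n => ?_, fun n => ?_⟩ <;> rw [cocompact_eq_atBot_atTop]
  · exact (((superpolynomialDecay_parabolicD_neg ν).const_mul c).congr' hbot.symm n).sup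
      (((superpolynomialDecay_parabolicD ν).const_mul d).congr' htop.symm n)
  · exact (((superpolynomialDecay_deriv_parabolicD_neg ν).const_mul c).congr' hbot'.symm n).sup
      (((superpolynomialDecay_deriv_parabolicD ν).const_mul d).congr' htop'.symm n)

theorem cauchySol_eventuallyEq_zero_iff {ν α β : ℂ} :
    cauchySol ν α β =ᶠ[atBot] 0 ↔ α = 0 ∧ β = 0 := by
  refine ⟨fun h => ?_, ?_⟩
  · obtain ⟨c, hc⟩ := eventually_atBot.1 h
    have hzero : cauchySol ν α β =ᶠ[𝓝 (c - 1)] fun _ => 0 := by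
      filter_upwards [Iio_mem_nhds (sub_one_lt c)] with x hx using hc x hx.le
    have hW (γ δ : ℂ) : α * δ - β * γ = 0 := by
      rw [← wronskian_cauchySol ν α β γ δ (c - 1), wronskian, hzero.eq_of_nhds, hzero.deriv_eq,
        deriv_const, zero_mul, zero_mul, sub_zero]
    exact ⟨by simpa using hW 0 1, by simpa using hW 1 0⟩
  · rintro ⟨rfl, rfl⟩
    exact .of_eq (funext fun x => by simp [cauchySol])

theorem parabolicD_neg_not_eventuallyEq_zero (ν : ℂ) :
    ¬(fun x : ℝ => parabolicD ν (-x)) =ᶠ[atBot] 0 := by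
  rw [parabolicD_neg_eq_cauchySol, cauchySol_eventuallyEq_zero_iff, not_and_or]
  exact evenWeight_ne_zero_or_oddWeight_ne_zero ν

/-! ### Shooting across the point interactions -/

/-- The solution that vanishes on `(-∞, p]` and whose derivative jumps by `1` at `p`. -/
def impulse (ν : ℂ) (p : ℝ) : ℝ → ℂ :=
  (Ioi p).indicator (cauchySol ν (-yOdd ν p) (yEven ν p))

/-- The derivative of `impulse ν p` away from `p`. -/
def impulseDeriv (ν : ℂ) (p : ℝ) : ℝ → ℂ :=
  (Ioi p).indicator (deriv (cauchySol ν (-yOdd ν p) (yEven ν p)))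

theorem isJumpSolution_impulse (ν : ℂ) (p : ℝ) :
    IsJumpSolution ν (Finsupp.single p 1) (impulse ν p) (impulseDeriv ν p) where
  isPrimitive := (isJumpSolution_cauchySol ν _ _).isPrimitive.indicator_Ioi <| by
    rw [cauchySol]
    ring
  isPrimitive_sub_jumpStep := by
    have hslope : deriv (cauchySol ν (-yOdd ν p) (yEven ν p)) p = 1 := by
      have hW := wronskian_cauchySol ν 1 0 0 1 p
      simp only [wronskian, (hasDerivAt_cauchySol ν _ _ p).deriv, cauchySol] at hW ⊢
      linear_combination hW
    have hS := ((isJumpSolution_cauchySol ν (-yOdd ν p) (yEven ν p)).isPrimitive_deriv.add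
      (.of_hasDerivAt (fun x => hasDerivAt_const x (-1)) continuous_const)).indicator_Ioi
      (p := p) (by rw [Pi.add_apply, hslope, add_neg_cancel])
    convert hS using 1 <;> funext x <;> rcases le_or_gt x p with hxp | hxp
    all_goals
      simp only [impulse, impulseDeriv, jumpStep_single, indicator, mem_Ioi, hxp, hxp.not_gt,
        if_true, if_false, Pi.sub_apply, Pi.add_apply, Pi.smul_apply, smul_eq_mul, Pi.one_apply]
      ring

theorem impulse_eventuallyEq_atBot (ν : ℂ) (p : ℝ) : impulse ν p =ᶠ[atBot] 0 := by
  filter_upwards [eventually_le_atBot p] with x hx using indicator_of_notMem (notMem_Ioi.2 hx) _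

theorem impulseDeriv_eventuallyEq_atBot (ν : ℂ) (p : ℝ) : impulseDeriv ν p =ᶠ[atBot] 0 := by
  filter_upwards [eventually_le_atBot p] with x hx using indicator_of_notMem (notMem_Ioi.2 hx) _

/-- The jumps `z u(b)` at `b` and `-z u(-b)` at `-b` that the interaction
`z [δ(x - b) - δ(x + b)]` imposes on the derivative of `u`. -/
def pointJumps (z : ℂ) (b : ℝ) : (ℝ → ℂ) →ₗ[ℂ] ℝ →₀ ℂ :=
  let eval (p : ℝ) : (ℝ → ℂ) →ₗ[ℂ] ℂ := LinearMap.proj p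
  z • (Finsupp.lsingle b ∘ₗ eval b - Finsupp.lsingle (-b) ∘ₗ eval (-b))

theorem pointJumps_apply (z : ℂ) (b : ℝ) (u : ℝ → ℂ) :
    pointJumps z b u =
      (z * u b) • Finsupp.single b 1 - (z * u (-b)) • Finsupp.single (-b) 1 := by
  simp [pointJumps, smul_sub]

theorem linearCombination_pointJumps (z : ℂ) (b : ℝ) (f u : ℝ → ℂ) :
    Finsupp.linearCombination ℂ f (pointJumps z b u) = z * (f b * u b - f (-b) * u (-b)) := by
  simp only [pointJumps_apply, map_sub, map_smul, Finsupp.linearCombination_single, smul_eq_mul]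
  ring

theorem IsJumpSolution.exists_add_pointJumps {ν : ℂ} {J : ℝ →₀ ℂ} {u u' : ℝ → ℂ}
    (hu : IsJumpSolution ν J u u') (z : ℂ) {b : ℝ} (hb : 0 < b) :
    ∃ v v', IsJumpSolution ν (J + pointJumps z b v) v v' ∧ v =ᶠ[atBot] u ∧ v' =ᶠ[atBot] u' ∧
      v (-b) = u (-b) ∧ v b = u b - z * u (-b) * (2 * yEven ν b * yOdd ν b) := by
  set c := z * u (-b)
  set d := z * (u b - c * (2 * yEven ν b * yOdd ν b)) with hd
  have hleft : impulse ν (-b) (-b) = 0 ∧ impulse ν b (-b) = 0 ∧ impulse ν b b = 0 := by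
    simp [impulse, hb.le]
  have hright : impulse ν (-b) b = 2 * yEven ν b * yOdd ν b := by
    rw [impulse, indicator_of_mem (mem_Ioi.2 (neg_lt_self hb)), cauchySol, Complex.ofReal_neg,
      yEven_neg, yOdd_neg]
    ring
  refine ⟨u + ((-c) • impulse ν (-b) + d • impulse ν b),
    u' + ((-c) • impulseDeriv ν (-b) + d • impulseDeriv ν b), ?_, ?_, ?_, ?_, ?_⟩
  · convert hu.add (((isJumpSolution_impulse ν (-b)).const_smul (-c)).add
      ((isJumpSolution_impulse ν b).const_smul d)) using 2
    simp only [pointJumps_apply, Pi.add_apply, Pi.smul_apply, smul_eq_mul, hleft, hright, hd, c]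
    module
  · filter_upwards [impulse_eventuallyEq_atBot ν (-b), impulse_eventuallyEq_atBot ν b] with x hx hx'
    simp [hx, hx']
  · filter_upwards [impulseDeriv_eventuallyEq_atBot ν (-b), impulseDeriv_eventuallyEq_atBot ν b]
      with x hx hx'
    simp [hx, hx']
  · simp [hleft]
  · simp only [Pi.add_apply, Pi.smul_apply, smul_eq_mul, hleft, hright]
    ring

/-- The characteristic function of `L_{z,b}`, whose zeros are the eigenvalues. -/
def charFun (z ν : ℂ) (b : ℝ) : ℂ :=
  (Complex.Gamma (-ν))⁻¹
    - z ^ 2 * parabolicD ν b ^ 2 * ((√(2 / Real.pi) : ℂ) * yEven ν b * yOdd ν b)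

theorem sqrt_two_pi_mul_charFun (z ν : ℂ) (b : ℝ) :
    (√(2 * Real.pi) : ℂ) * charFun z ν b =
      2 * (evenWeight ν * oddWeight ν - z ^ 2 * parabolicD ν b ^ 2 * (yEven ν b * yOdd ν b)) := by
  have hsqrt : (√(2 * Real.pi) : ℂ) * (√(2 / Real.pi) : ℂ) = 2 := by
    rw [← Complex.ofReal_mul, ← Real.sqrt_mul (by positivity),
      show 2 * Real.pi * (2 / Real.pi) = 2 * 2 by field_simp, Real.sqrt_mul_self zero_le_two,
      Complex.ofReal_ofNat]
  rw [charFun]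
  linear_combination sqrt_two_pi_mul_inv_Gamma ν -
    z ^ 2 * parabolicD ν b ^ 2 * (yEven ν b * yOdd ν b) * hsqrt

/-- `D_ν(-x)` continued across the two point interactions ends up recessive at `+∞` exactly when
the characteristic function vanishes. -/
theorem exists_shootingSolution (z ν : ℂ) {b : ℝ} (hb : 0 < b) :
    ∃ u u', IsJumpSolution ν (pointJumps z b u) u u' ∧
      (u =ᶠ[atBot] fun x : ℝ => parabolicD ν (-x)) ∧
      (u' =ᶠ[atBot] deriv fun x : ℝ => parabolicD ν (-x)) ∧
      ∀ᶠ x in atTop, wronskian u u' (fun x : ℝ => parabolicD ν x)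
        (deriv fun x : ℝ => parabolicD ν x) x = -((√(2 * Real.pi) : ℂ) * charFun z ν b) := by
  have hD := parabolicD_eq_cauchySol ν
  have hDneg := parabolicD_neg_eq_cauchySol ν
  obtain ⟨u, u', hu, hbot, hbot', hleft, hright⟩ :=
    (isJumpSolution_cauchySol ν (evenWeight ν) (oddWeight ν)).exists_add_pointJumps z hb
  rw [zero_add] at hu
  refine ⟨u, u', hu, hDneg ▸ hbot, hDneg ▸ hbot', ?_⟩
  obtain ⟨w, hwbot, hwtop⟩ := hu.exists_wronskian_eventuallyEq
    (isJumpSolution_cauchySol ν (evenWeight ν) (-oddWeight ν))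
  have hw : w = -(2 * (evenWeight ν * oddWeight ν)) := by
    obtain ⟨x, hux, hux', hwx⟩ := (hbot.and (hbot'.and hwbot)).exists
    have hW := wronskian_cauchySol ν (evenWeight ν) (oddWeight ν) (evenWeight ν) (-oddWeight ν) x
    rw [← hwx]
    rw [wronskian, ← hux, ← hux', ← wronskian] at hW
    linear_combination hW
  filter_upwards [hwtop] with x hx
  rw [hD, hx, hw, linearCombination_pointJumps, hleft, hright, sqrt_two_pi_mul_charFun]
  have hDb := congrFun hD b
  have hDb' := congrFun hD (-b)
  have hDnegb := congrFun hDneg b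
  have hDnegb' := congrFun hDneg (-b)
  simp only [Complex.ofReal_neg, neg_neg] at hDb' hDnegb'
  rw [← hDb, ← hDb', ← hDnegb, ← hDnegb']
  ring

theorem exists_isDecayingSolution_of_charFun_eq_zero {z ν : ℂ} {b : ℝ} (hb : 0 < b)
    (h0 : charFun z ν b = 0) :
    ∃ u u', IsDecayingSolution ν (pointJumps z b u) u u' ∧ u ≠ 0 := by
  obtain ⟨u, u', hu, hbot, hbot', hW⟩ := exists_shootingSolution z ν hb
  simp only [h0, mul_zero, neg_zero] at hW
  refine ⟨u, u', hu.isDecayingSolution (c := 1) (by rwa [one_smul]) (by rwa [one_smul]) hW, ?_⟩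
  rintro rfl
  exact parabolicD_neg_not_eventuallyEq_zero ν hbot.symm

theorem exists_isDecayingSolution_single_add_pointJumps {z ν : ℂ} {b : ℝ} (hb : 0 < b)
    (h0 : charFun z ν b ≠ 0) (p : ℝ) :
    ∃ u u', IsDecayingSolution ν (Finsupp.single p 1 + pointJumps z b u) u u' := by
  obtain ⟨v, v', hv, hvbot, hvbot', hvW⟩ := exists_shootingSolution z ν hb
  obtain ⟨k, k', hk, hkbot, hkbot', -, -⟩ := (isJumpSolution_impulse ν p).exists_add_pointJumps z hb
  obtain ⟨w, -, hkW⟩ := hk.exists_wronskian_eventuallyEq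
    (isJumpSolution_cauchySol ν (evenWeight ν) (-oddWeight ν))
  rw [← parabolicD_eq_cauchySol] at hkW
  set W := -((√(2 * Real.pi) : ℂ) * charFun z ν b)
  have hW : W ≠ 0 := neg_ne_zero.2 (mul_ne_zero
    (Complex.ofReal_ne_zero.2 (Real.sqrt_ne_zero'.2 (by positivity))) h0)
  set w' := w - Finsupp.linearCombination ℂ (fun x : ℝ => parabolicD ν x)
    (Finsupp.single p 1 + pointJumps z b k)
  set c := -(w' / W) with hc
  refine ⟨k + c • v, k' + c • v', IsJumpSolution.isDecayingSolution (c := c) ?_ ?_ ?_ ?_⟩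
  · rw [map_add, map_smul, ← add_assoc]
    exact hk.add (hv.const_smul c)
  · filter_upwards [hkbot, hvbot, impulse_eventuallyEq_atBot ν p] with x hkx hvx hx
    simp only [Pi.add_apply, Pi.smul_apply, hkx, hvx, hx, Pi.zero_apply, zero_add]
  · filter_upwards [hkbot', hvbot', impulseDeriv_eventuallyEq_atBot ν p] with x hkx hvx hx
    simp only [Pi.add_apply, Pi.smul_apply, hkx, hvx, hx, Pi.zero_apply, zero_add]
  · filter_upwards [hkW, hvW] with x hkx hvx
    simp only [wronskian, Pi.add_apply, Pi.smul_apply, smul_eq_mul] at hkx hvx ⊢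
    have hcW : c * W = -w' := by rw [hc, neg_mul, div_mul_cancel₀ w' hW]
    linear_combination hkx + c * hvx + hcW

/-! ### Green's identity -/

theorem measurable_jumpStep (v : ℝ → ℂ) (J : ℝ →₀ ℂ) : Measurable (jumpStep v J) := by
  induction J using Finsupp.induction_linear with
  | zero => simpa only [jumpStep, map_zero] using measurable_zero
  | add J K hJ hK => simpa only [jumpStep, map_add] using hJ.add hK
  | single p c =>
    rw [jumpStep_single]
    exact (measurable_const.indicator measurableSet_Ioi).const_smul c

theorem exists_norm_jumpStep_le (v : ℝ → ℂ) (J : ℝ →₀ ℂ) : ∃ C, ∀ x, ‖jumpStep v J x‖ ≤ C := by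
  induction J using Finsupp.induction_linear with
  | zero => exact ⟨0, fun x => by simp [jumpStep]⟩
  | add J K hJ hK =>
    obtain ⟨C, hC⟩ := hJ
    obtain ⟨C', hC'⟩ := hK
    refine ⟨C + C', fun x => ?_⟩
    rw [jumpStep, map_add]
    exact norm_add_le_of_le (hC x) (hC' x)
  | single p c =>
    refine ⟨‖c‖ * ‖v p‖, fun x => ?_⟩
    rw [jumpStep_single, Pi.smul_apply, norm_smul]
    gcongr
    exact norm_indicator_le_norm_self (fun _ => v p) x

theorem form_eq_form_conj (z : ℂ) (b : ℝ) {f g : ℝ → ℂ} (hf : f ∈ formDomain)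
    (hg : g ∈ formDomain) :
    form z b f g = form z b (fun x => conj (g x)) (fun x => conj (f x)) := by
  have hderiv : ∫ x, weakDeriv (fun x => conj (g x)) x * conj (weakDeriv (fun x => conj (f x)) x) =
      ∫ x, weakDeriv f x * conj (weakDeriv g x) := by
    refine integral_congr_ae ?_
    filter_upwards [weakDeriv_conj hf, weakDeriv_conj hg] with x hfx hgx
    rw [hfx, hgx, Complex.conj_conj, mul_comm]
  simp only [form, hderiv, map_mul, Complex.conj_conj, Complex.conj_ofReal]
  simp only [mul_comm (conj (g _)) (f _), mul_comm (_ * conj (g _)) (_ * f _)]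

namespace IsDecayingSolution

variable {ν : ℂ} {J : ℝ →₀ ℂ} {u u' : ℝ → ℂ}

theorem memLp_deriv (hu : IsDecayingSolution ν J u u') : MemLp u' 2 := by
  have hcont := hu.isPrimitive_sub_jumpStep.continuous
  have hsplit : u' = (u' - jumpStep 1 J) + jumpStep 1 J := (sub_add_cancel _ _).symm
  refine memLp_two_of_superpolynomialDecay ?_ (fun K hK => ?_) hu.superpolynomialDecay_deriv
  · rw [hsplit]
    exact (hcont.measurable.add (measurable_jumpStep 1 J)).aestronglyMeasurable
  · obtain ⟨C, hC⟩ := hK.exists_bound_of_continuousOn hcont.continuousOn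
    obtain ⟨C', hC'⟩ := exists_norm_jumpStep_le 1 J
    rw [hsplit]
    exact ⟨C + C', fun x hx => norm_add_le_of_le (hC x hx) (hC' x)⟩

theorem mem_formDomain (hu : IsDecayingSolution ν J u u') : u ∈ formDomain := by
  have hcont := hu.isPrimitive.continuous
  have hmemLp {F : ℝ → ℂ} (hF : Continuous F)
      (hd : SuperpolynomialDecay (cocompact ℝ) (fun x : ℝ => (x : ℂ)) F) : MemLp F 2 :=
    memLp_two_of_superpolynomialDecay hF.aestronglyMeasurable
      (fun K hK => hK.exists_bound_of_continuousOn hF.continuousOn) hd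
  exact ⟨hcont, hmemLp hcont hu.superpolynomialDecay,
    ⟨u', hu.memLp_deriv, hu.isPrimitive.isWeakDeriv⟩,
    hmemLp (Complex.continuous_ofReal.mul hcont) hu.superpolynomialDecay.param_mul⟩

theorem integral_green (hu : IsDecayingSolution ν J u u') {f : ℝ → ℂ} (hf : f ∈ formDomain) :
    (∫ x, weakDeriv f x * u' x) + (1 / 4) * (∫ x : ℝ, (x : ℂ) * f x * ((x : ℂ) * u x)) -
      (1 / 2 + ν) * (∫ x, f x * u x) = -Finsupp.linearCombination ℂ f J := by
  have hprim := isPrimitive_weakDeriv hf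
  obtain ⟨-, hf2, hfd, hfx⟩ := hf
  obtain ⟨-, hu2, -, hux⟩ := hu.mem_formDomain
  have hfd2 := (weakDeriv_spec hfd).1
  have hderiv : Integrable fun x => weakDeriv f x * u' x := hfd2.integrable_mul hu.memLp_deriv
  have hpot : Integrable fun x : ℝ => 1 / 4 * ((x : ℂ) * f x * ((x : ℂ) * u x)) :=
    (hfx.integrable_mul hux).const_mul (1 / 4)
  have hmass : Integrable fun x => (1 / 2 + ν) * (f x * u x) :=
    (hf2.integrable_mul hu2).const_mul (1 / 2 + ν)
  have henergy : Integrable fun x : ℝ =>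
      weakDeriv f x * u' x + 1 / 4 * ((x : ℂ) * f x * ((x : ℂ) * u x)) := hderiv.add hpot
  have hdecay : Tendsto (fun x => f x * u' x) (cocompact ℝ) (𝓝 0) :=
    tendsto_mul_of_isBigO_of_superpolynomialDecay (hprim.isBigO_id hfd2)
      hu.superpolynomialDecay_deriv
  rw [cocompact_eq_atBot_atTop, tendsto_sup] at hdecay
  have hgreen := (hu.isPrimitive_mul_sub_jumpStep hprim).integral_eq_sub_of_tendsto
    ((henergy.sub hmass).congr (.of_forall fun x => ?_))
    (hdecay.1.sub (tendsto_const_nhds.congr' (jumpStep_eventuallyEq_atBot f J).symm))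
    (hdecay.2.sub (tendsto_const_nhds.congr' (jumpStep_eventuallyEq_atTop f J).symm))
  · simp only [sub_zero, zero_sub] at hgreen
    rw [← hgreen, ← integral_const_mul, ← integral_const_mul, ← integral_add hderiv hpot,
      ← integral_sub henergy hmass]
    exact integral_congr_ae (.of_forall fun x => by ring)
  · rw [Pi.sub_apply]
    ring

theorem form_conj_eq (hu : IsDecayingSolution ν J u u') (z : ℂ) (b : ℝ) {f : ℝ → ℂ}
    (hf : f ∈ formDomain) :
    form z b f (fun x => conj (u x)) =
      ν * (∫ x, f x * u x) + Finsupp.linearCombination ℂ f (pointJumps z b u - J) := by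
  have hderiv : ∫ x, weakDeriv f x * conj (weakDeriv (fun x => conj (u x)) x) =
      ∫ x, weakDeriv f x * u' x := by
    refine integral_congr_ae ?_
    filter_upwards [weakDeriv_conj hu.mem_formDomain,
      weakDeriv_ae_eq hu.memLp_deriv hu.isPrimitive.isWeakDeriv] with x hconj hx
    rw [hconj, hx, Complex.conj_conj]
  simp only [form, hderiv, map_mul, Complex.conj_conj, Complex.conj_ofReal, map_sub,
    linearCombination_pointJumps]
  linear_combination hu.integral_green hf

end IsDecayingSolution

theorem exists_eigenfunction_of_charFun_eq_zero {z ν : ℂ} {b : ℝ} (hb : 0 < b)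
    (h0 : charFun z ν b = 0) :
    ∃ f ∈ formDomain, f ≠ 0 ∧
      ∀ g ∈ formDomain, form z b f g = ν * ∫ x, f x * conj (g x) := by
  obtain ⟨u, u', hu, hne⟩ := exists_isDecayingSolution_of_charFun_eq_zero hb h0
  refine ⟨u, hu.mem_formDomain, hne, fun g hg => ?_⟩
  rw [form_eq_form_conj z b hu.mem_formDomain hg, hu.form_conj_eq z b (conj_mem_formDomain hg),
    sub_self, map_zero, add_zero]
  simp only [mul_comm]

/-- Testing against the Green function with pole `p` recovers `f p`. -/
theorem eq_zero_of_forall_form_eq {z ν : ℂ} {b : ℝ} (hb : 0 < b) (h0 : charFun z ν b ≠ 0)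
    {f : ℝ → ℂ} (hf : f ∈ formDomain)
    (h : ∀ g ∈ formDomain, form z b f g = ν * ∫ x, f x * conj (g x)) : f = 0 := by
  funext p
  obtain ⟨u, u', hu⟩ := exists_isDecayingSolution_single_add_pointJumps hb h0 p
  have hform := h _ (conj_mem_formDomain hu.mem_formDomain)
  simp only [hu.form_conj_eq z b hf, Complex.conj_conj, add_eq_left, sub_add_cancel_right, map_neg,
    Finsupp.linearCombination_single, one_smul, neg_eq_zero] at hform
  exact hform

/-! ### Operators that are coercive on a subspace of finite codimension -/

theorem surjective_of_isCompl_map {k V : Type*} [Field k] [AddCommGroup V] [Module k V]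
    {T : V →ₗ[k] V} (hT : Function.Injective T) {K C : Submodule k V} (hK : IsCompl K C)
    (hTK : IsCompl (K.map T) C) [FiniteDimensional k (V ⧸ K)] : Function.Surjective T := by
  let e : (V ⧸ K) ≃ₗ[k] V ⧸ K.map T :=
    (K.quotientEquivOfIsCompl C hK).trans ((K.map T).quotientEquivOfIsCompl C hTK).symm
  have : FiniteDimensional k (V ⧸ K.map T) := e.finiteDimensional
  let Q : (V ⧸ K) →ₗ[k] V ⧸ K.map T := K.mapQ (K.map T) T (Submodule.le_comap_map T K)
  have hQ : Function.Injective Q := by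
    refine LinearMap.ker_eq_bot.1 ?_
    rw [Submodule.ker_mapQ, Submodule.comap_map_eq_of_injective hT, Submodule.mkQ_map_self]
  have hQ' := (LinearMap.injective_iff_surjective_of_finrank_eq_finrank e.finrank_eq).1 hQ
  intro y
  obtain ⟨q, hq⟩ := hQ' (Submodule.Quotient.mk y)
  obtain ⟨v, rfl⟩ := Submodule.Quotient.mk_surjective K q
  rw [Submodule.mapQ_apply, eq_comm, Submodule.Quotient.eq] at hq
  obtain ⟨w, -, hw⟩ := hq
  exact ⟨w + v, by rw [map_add, hw, sub_add_cancel]⟩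

section Coercive

variable {V : Type*} [NormedAddCommGroup V] [InnerProductSpace ℂ V]

theorem isCompl_map_orthogonal {T : V →ₗ[ℂ] V} {K : Submodule ℂ V} [K.HasOrthogonalProjection]
    (hT : Function.Bijective fun v : K => K.orthogonalProjectionOnto (T v)) :
    IsCompl (K.map T) Kᗮ := by
  refine ⟨Submodule.disjoint_def.2 ?_, codisjoint_iff_le_sup.2 fun v _ => ?_⟩
  · rintro _ ⟨v, hv, rfl⟩ hTv
    have hzero : (⟨v, hv⟩ : K) = 0 := hT.1 (by
      simpa using K.orthogonalProjectionOnto_eq_zero_iff.2 hTv)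
    rw [show v = 0 from congrArg Subtype.val hzero, map_zero]
  · obtain ⟨w, hw⟩ := hT.2 (K.orthogonalProjectionOnto v)
    refine Submodule.mem_sup.2 ⟨T w, Submodule.mem_map_of_mem w.2, v - T w, ?_,
      add_sub_cancel _ _⟩
    rw [← K.orthogonalProjectionOnto_eq_zero_iff, map_sub, sub_eq_zero]
    exact hw.symm

theorem surjective_of_coercive_on_ker [CompleteSpace V] {T : V →L[ℂ] V}
    (hT : Function.Injective T) {W : Type*} [NormedAddCommGroup W] [NormedSpace ℂ W]
    [FiniteDimensional ℂ W] (Φ : V →L[ℂ] W) {c : ℝ} (hc : 0 < c)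
    (hΦ : ∀ v, Φ v = 0 → c * ‖v‖ ^ 2 ≤ (inner ℂ v (T v)).re) : Function.Surjective T := by
  let K : Submodule ℂ V := Φ.ker
  have : CompleteSpace K := Φ.isClosed_ker.completeSpace_coe
  have : FiniteDimensional ℂ (V ⧸ K) :=
    (Φ : V →ₗ[ℂ] W).quotKerEquivRange.symm.finiteDimensional
  let A : K →L[ℂ] K := K.orthogonalProjectionOnto ∘L T ∘L K.subtypeL
  have hA : IsUnit A := by
    refine A.isUnit_of_forall_le_norm_inner_map (c := ⟨c, hc.le⟩) hc fun v => ?_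
    rw [norm_inner_symm, show inner ℂ v (A v) = inner ℂ (v : V) (T v) from
      K.inner_orthogonalProjectionOnto_eq_of_mem_left v (T v), mul_comm]
    exact (hΦ v v.2).trans (Complex.re_le_norm _)
  exact surjective_of_isCompl_map (T := (T : V →ₗ[ℂ] V)) hT K.isCompl_orthogonal
    (isCompl_map_orthogonal (ContinuousLinearMap.isUnit_iff_bijective.1 hA))

end Coercive

/-! ### The form domain as a Hilbert space -/

theorem inner_eq_integral {v w : L2} {f g : ℝ → ℂ} (hv : v =ᵐ[volume] f) (hw : w =ᵐ[volume] g) :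
    inner ℂ w v = ∫ x, f x * conj (g x) := by
  rw [L2.inner_def]
  refine integral_congr_ae ?_
  filter_upwards [hv, hw] with x hvx hwx
  rw [hvx, hwx, RCLike.inner_apply]

theorem norm_sq_eq_integral {v : L2} {f : ℝ → ℂ} (hv : v =ᵐ[volume] f) :
    ‖v‖ ^ 2 = ∫ x, ‖f x‖ ^ 2 := by
  have h := inner_eq_integral hv hv
  simp only [inner_self_eq_norm_sq_to_K, Complex.mul_conj', ← Complex.ofReal_pow,
    integral_complex_ofReal] at h
  exact Complex.ofReal_injective ((Complex.ofReal_pow _ _).trans h)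

/-- Integration against a continuous compactly supported function, as a functional on `L²(ℝ)`. -/
def testFunctional (φ : ℝ → ℝ) (hφ : Continuous φ) (hc : HasCompactSupport φ) : L2 →L[ℂ] ℂ :=
  innerSL ℂ (MemLp.toLp (fun x => (φ x : ℂ))
    ((Complex.continuous_ofReal.comp hφ).memLp_of_hasCompactSupport
      (hc.comp_left Complex.ofReal_zero)))

theorem testFunctional_apply {φ : ℝ → ℝ} (hφ : Continuous φ) (hc : HasCompactSupport φ) (w : L2) :
    testFunctional φ hφ hc w = ∫ x, φ x • w x := by
  rw [testFunctional, innerSL_apply_apply,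
    inner_eq_integral EventuallyEq.rfl (MemLp.coeFn_toLp _)]
  simp only [Complex.conj_ofReal, Complex.real_smul, mul_comm]

/-- The ambient Hilbert space of the triples `(f, f', x f)`. -/
abbrev Triple : Type := PiLp 2 fun _ : Fin 3 => L2

/-- Smooth compactly supported functions, bundled so that they can index an infimum. -/
abbrev TestFn : Type := {φ : ℝ → ℝ // ContDiff ℝ ∞ φ ∧ HasCompactSupport φ}

/-- The functional whose vanishing for all `φ` says that the second component of a triple is the
weak derivative of the first. -/
def derivFunctional (φ : TestFn) : Triple →L[ℂ] ℂ :=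
  testFunctional (deriv φ.1) (φ.2.1.continuous_deriv (by simp)) φ.2.2.deriv ∘L PiLp.proj 2 _ 0
    + testFunctional φ.1 φ.2.1.continuous φ.2.2 ∘L PiLp.proj 2 _ 1

/-- The functional whose vanishing for all `φ` says that the third component of a triple is `x`
times the first. -/
def mulFunctional (φ : TestFn) : Triple →L[ℂ] ℂ :=
  testFunctional φ.1 φ.2.1.continuous φ.2.2 ∘L PiLp.proj 2 _ 2
    - testFunctional (fun x => x * φ.1 x) (continuous_id.mul φ.2.1.continuous) φ.2.2.mul_left ∘L
      PiLp.proj 2 _ 0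

/-- The form domain with its graph norm, realised as the space of the triples `(f, f', x f)` with
`f ∈ formDomain`; being cut out by continuous functionals, it is closed. -/
def formSpace : Submodule ℂ Triple :=
  ⨅ φ : TestFn, (derivFunctional φ).ker ⊓ (mulFunctional φ).ker

theorem isClosed_formSpace : IsClosed (formSpace : Set Triple) := by
  simp only [formSpace, Submodule.coe_iInf, Submodule.coe_inf]
  exact isClosed_iInter fun φ =>
    (derivFunctional φ).isClosed_ker.inter (mulFunctional φ).isClosed_ker

instance : CompleteSpace formSpace := isClosed_formSpace.completeSpace_coe

theorem ae_eq_ofReal_mul_iff {u w : L2} :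
    w =ᵐ[volume] (fun x : ℝ => (x : ℂ) * u x) ↔
      ∀ φ : ℝ → ℝ, ContDiff ℝ ∞ φ → HasCompactSupport φ →
        ∫ x, φ x • w x = ∫ x, (x * φ x) • u x := by
  have hmul : ∀ (φ : ℝ → ℝ) (x : ℝ), (x * φ x) • u x = φ x • ((x : ℂ) * u x) := fun φ x => by
    rw [mul_comm, mul_smul, Complex.real_smul (x := x)]
  simp only [hmul]
  refine ⟨fun h φ _ _ => integral_congr_ae (h.mono fun x hx => congrArg (φ x • ·) hx),
    ae_eq_of_integral_contDiff_smul_eq ((Lp.memLp w).locallyIntegrable one_le_two) ?_⟩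
  exact locallyIntegrable_iff.2 fun K hK => IntegrableOn.continuousOn_mul
    Complex.continuous_ofReal.continuousOn
    (((Lp.memLp u).locallyIntegrable one_le_two).integrableOn_isCompact hK) hK

theorem mem_formSpace_iff {v : Triple} :
    v ∈ formSpace ↔ IsWeakDeriv (v 0) (v 1) ∧ v 2 =ᵐ[volume] fun x : ℝ => (x : ℂ) * v 0 x := by
  simp only [ae_eq_ofReal_mul_iff, formSpace, Submodule.mem_iInf, Submodule.mem_inf,
    LinearMap.mem_ker, ContinuousLinearMap.coe_coe, derivFunctional, mulFunctional, add_apply,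
    sub_apply, ContinuousLinearMap.comp_apply, PiLp.proj_apply,
    testFunctional_apply, add_eq_zero_iff_eq_neg, sub_eq_zero]
  exact ⟨fun h => ⟨fun φ hφ hc => (h ⟨φ, hφ, hc⟩).1, fun φ hφ hc => (h ⟨φ, hφ, hc⟩).2⟩,
    fun h φ => ⟨h.1 φ.1 φ.2.1 φ.2.2, h.2 φ.1 φ.2.1 φ.2.2⟩⟩

theorem IsWeakDeriv.congr {f₁ f₂ g₁ g₂ : ℝ → ℂ} (h : IsWeakDeriv f₁ g₁) (hf : f₁ =ᵐ[volume] f₂)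
    (hg : g₁ =ᵐ[volume] g₂) : IsWeakDeriv f₂ g₂ := fun φ hφ hc => by
  rw [← integral_congr_ae (hf.mono fun x hx => congrArg (deriv φ x • ·) hx),
    ← integral_congr_ae (hg.mono fun x hx => congrArg (φ x • ·) hx), h φ hφ hc]

/-- The element `(f, f', x f)` of the Hilbert space `formSpace` given by `f ∈ formDomain`. -/
def toFormSpace {f : ℝ → ℂ} (hf : f ∈ formDomain) : formSpace :=
  ⟨WithLp.toLp 2 ![hf.2.1.toLp f, (weakDeriv_spec hf.2.2.1).1.toLp (weakDeriv f),
    hf.2.2.2.toLp (fun x : ℝ => (x : ℂ) * f x)], mem_formSpace_iff.2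
    ⟨(weakDeriv_spec hf.2.2.1).2.congr hf.2.1.coeFn_toLp.symm
      (weakDeriv_spec hf.2.2.1).1.coeFn_toLp.symm, by
      filter_upwards [hf.2.1.coeFn_toLp, hf.2.2.2.coeFn_toLp] with x h0 h2
      exact h2.trans (congrArg ((x : ℂ) * ·) h0.symm)⟩⟩

/-- The components `f`, `f'`, `x f` of an element of `formSpace`. -/
def component (i : Fin 3) : formSpace →L[ℂ] L2 :=
  PiLp.proj 2 (fun _ : Fin 3 => L2) i ∘L formSpace.subtypeL

theorem component_zero {f : ℝ → ℂ} (hf : f ∈ formDomain) :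
    component 0 (toFormSpace hf) =ᵐ[volume] f := hf.2.1.coeFn_toLp

theorem component_one {f : ℝ → ℂ} (hf : f ∈ formDomain) :
    component 1 (toFormSpace hf) =ᵐ[volume] weakDeriv f := (weakDeriv_spec hf.2.2.1).1.coeFn_toLp

theorem component_two {f : ℝ → ℂ} (hf : f ∈ formDomain) :
    component 2 (toFormSpace hf) =ᵐ[volume] fun x : ℝ => (x : ℂ) * f x := hf.2.2.2.coeFn_toLp

theorem norm_sq_formSpace (v : formSpace) :
    ‖v‖ ^ 2 = ‖component 0 v‖ ^ 2 + ‖component 1 v‖ ^ 2 + ‖component 2 v‖ ^ 2 := by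
  have h := PiLp.norm_sq_eq_of_L2 (fun _ : Fin 3 => L2) (v : Triple)
  rwa [Fin.sum_univ_three] at h

theorem exists_toFormSpace_eq (v : formSpace) :
    ∃ (f : ℝ → ℂ) (hf : f ∈ formDomain), toFormSpace hf = v := by
  obtain ⟨v, hv⟩ := v
  obtain ⟨hderiv, hmul⟩ := mem_formSpace_iff.1 hv
  obtain ⟨f, hvf, hP⟩ := hderiv.exists_isPrimitive (Lp.memLp _) (Lp.memLp _)
  have hmul' : v 2 =ᵐ[volume] fun x : ℝ => (x : ℂ) * f x :=
    hmul.trans (hvf.mono fun x hx => congrArg ((x : ℂ) * ·) hx)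
  have hf : f ∈ formDomain := ⟨hP.continuous, (memLp_congr_ae hvf).1 (Lp.memLp _),
    ⟨_, Lp.memLp _, hP.isWeakDeriv⟩, (memLp_congr_ae hmul').1 (Lp.memLp _)⟩
  refine ⟨f, hf, Subtype.ext ?_⟩
  ext i : 1
  fin_cases i
  · exact Lp.ext ((component_zero hf).trans hvf.symm)
  · exact Lp.ext ((component_one hf).trans (weakDeriv_ae_eq (Lp.memLp _) hP.isWeakDeriv))
  · exact Lp.ext ((component_two hf).trans hmul'.symm)

theorem eq_zero_of_component_zero_eq_zero {v : formSpace} (h : component 0 v = 0) : v = 0 := by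
  obtain ⟨f, hf, rfl⟩ := exists_toFormSpace_eq v
  have hf0 : f = 0 := (hf.1.ae_eq_iff_eq volume continuous_zero).1
    ((component_zero hf).symm.trans (Lp.eq_zero_iff_ae_eq_zero.1 h))
  subst hf0
  have h1 : component 1 (toFormSpace hf) = 0 := Lp.eq_zero_iff_ae_eq_zero.2
    ((component_one hf).trans (weakDeriv_ae_eq MemLp.zero isWeakDeriv_zero))
  have h2 : component 2 (toFormSpace hf) = 0 := Lp.eq_zero_iff_ae_eq_zero.2
    ((component_two hf).trans (Eventually.of_forall fun x => mul_zero _))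
  simpa [h, h1, h2] using norm_sq_formSpace (toFormSpace hf)

/-! ### Point evaluations -/

theorem memLp_indicator_Ioc {k : ℝ → ℂ} (hk : Continuous k) (s t : ℝ) :
    MemLp ((Ioc s t).indicator k) 2 := by
  obtain ⟨C, hC⟩ := (isCompact_Icc (a := s) (b := t)).exists_bound_of_continuousOn hk.continuousOn
  have : IsFiniteMeasure (volume.restrict (Ioc s t)) := ⟨by simp⟩
  rw [memLp_indicator_iff_restrict measurableSet_Ioc]
  exact MemLp.of_bound hk.aestronglyMeasurable C
    (ae_restrict_of_forall_mem measurableSet_Ioc fun x hx => hC x (Ioc_subset_Icc_self hx))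

theorem inner_indicator_Ioc {k : ℝ → ℂ} (hk : Continuous k) {s t : ℝ} (hst : s ≤ t) {w : L2}
    {g : ℝ → ℂ} (hw : w =ᵐ[volume] g) :
    inner ℂ ((memLp_indicator_Ioc hk s t).toLp _) w = ∫ x in s..t, g x * conj (k x) := by
  rw [inner_eq_integral hw (MemLp.coeFn_toLp _), intervalIntegral.integral_of_le hst,
    ← integral_indicator measurableSet_Ioc]
  refine integral_congr_ae (Eventually.of_forall fun x => ?_)
  by_cases hx : x ∈ Ioc s t <;> simp [hx]

/-- Evaluation at `p` as a functional on `formSpace`; it is given by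
`f(p) = ∫ f + ∫ (x - (p + 1)) f'` over `[p, p + 1]`, which makes its continuity evident. -/
def evalAt (p : ℝ) : formSpace →L[ℂ] ℂ :=
  innerSL ℂ ((memLp_indicator_Ioc (k := fun _ => 1) continuous_const p (p + 1)).toLp _) ∘L
      component 0
    + innerSL ℂ ((memLp_indicator_Ioc (k := fun x : ℝ => ((x - (p + 1) : ℝ) : ℂ))
      (by fun_prop) p (p + 1)).toLp _) ∘L component 1

theorem evalAt_toFormSpace (p : ℝ) {f : ℝ → ℂ} (hf : f ∈ formDomain) :
    evalAt p (toFormSpace hf) = f p := by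
  have hle : p ≤ p + 1 := by linarith
  have hP := isPrimitive_weakDeriv hf
  have hk : Continuous fun x : ℝ => ((x - (p + 1) : ℝ) : ℂ) := by fun_prop
  have hparts := (hP.mul (IsPrimitive.of_hasDerivAt (f := fun x : ℝ => ((x - (p + 1) : ℝ) : ℂ))
    (g := fun _ => 1) (fun x => ((hasDerivAt_id x).sub_const (p + 1)).ofReal_comp)
    continuous_const)).sub_eq p (p + 1)
  rw [intervalIntegral.integral_add ((hP.intervalIntegrable _ _).mul_continuousOn hk.continuousOn)
    (show IntervalIntegrable (fun x => f x * 1) volume p (p + 1) from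
      (hP.continuous.mul continuous_const).intervalIntegrable _ _)] at hparts
  simp only [evalAt, add_apply, ContinuousLinearMap.comp_apply, innerSL_apply_apply]
  rw [inner_indicator_Ioc continuous_const hle (component_zero hf),
    inner_indicator_Ioc hk hle (component_one hf)]
  simp only [map_one, Complex.conj_ofReal]
  rw [add_comm, ← hparts]
  push_cast
  ring

/-! ### The operator of the shifted form -/

section Combination

variable {V H : Type*} [NormedAddCommGroup V] [InnerProductSpace ℂ V] [CompleteSpace V]
  [NormedAddCommGroup H] [InnerProductSpace ℂ H] [CompleteSpace H]

open ContinuousLinearMap (adjoint) in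
/-- The operator that represents the sesquilinear form
`⟨A₁ ·, A₁ ·⟩ + c₂ ⟨A₂ ·, A₂ ·⟩ - c₀ ⟨A₀ ·, A₀ ·⟩ + z (e ē - e' ē')`. -/
def combinationOperator (A₀ A₁ A₂ : V →L[ℂ] H) (e e' : V →L[ℂ] ℂ) (c₀ c₂ z : ℂ) : V →L[ℂ] V :=
  adjoint A₁ ∘L A₁ + c₂ • (adjoint A₂ ∘L A₂) - c₀ • (adjoint A₀ ∘L A₀)
    + z • (adjoint e ∘L e - adjoint e' ∘L e')

theorem inner_combinationOperator (A₀ A₁ A₂ : V →L[ℂ] H) (e e' : V →L[ℂ] ℂ) (c₀ c₂ z : ℂ)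
    (v w : V) :
    inner ℂ w (combinationOperator A₀ A₁ A₂ e e' c₀ c₂ z v) = inner ℂ (A₁ w) (A₁ v)
      + c₂ * inner ℂ (A₂ w) (A₂ v) - c₀ * inner ℂ (A₀ w) (A₀ v)
      + z * (e v * conj (e w) - e' v * conj (e' w)) := by
  simp only [combinationOperator, add_apply, sub_apply, smul_apply, ContinuousLinearMap.comp_apply,
    inner_add_right, inner_sub_right, inner_smul_right, ContinuousLinearMap.adjoint_inner_right,
    RCLike.inner_apply]

end Combination

/-- The bounded operator on `formSpace` that represents the form `t(f, g) - ν ⟨f, g⟩`. -/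
def formOperator (z : ℂ) (b : ℝ) (ν : ℂ) : formSpace →L[ℂ] formSpace :=
  combinationOperator (component 0) (component 1) (component 2) (evalAt b) (evalAt (-b))
    (1 / 2 + ν) (1 / 4) z

section FormOperator

variable {z ν : ℂ} {b : ℝ}

theorem inner_formOperator (v w : formSpace) :
    inner ℂ w (formOperator z b ν v) = inner ℂ (component 1 w) (component 1 v)
      + 1 / 4 * inner ℂ (component 2 w) (component 2 v)
      - (1 / 2 + ν) * inner ℂ (component 0 w) (component 0 v)
      + z * (evalAt b v * conj (evalAt b w) - evalAt (-b) v * conj (evalAt (-b) w)) :=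
  inner_combinationOperator _ _ _ _ _ _ _ _ v w

theorem inner_formOperator_toFormSpace {f g : ℝ → ℂ} (hf : f ∈ formDomain) (hg : g ∈ formDomain) :
    inner ℂ (toFormSpace hg) (formOperator z b ν (toFormSpace hf))
      = form z b f g - ν * ∫ x, f x * conj (g x) := by
  rw [inner_formOperator, inner_eq_integral (component_one hf) (component_one hg),
    inner_eq_integral (component_two hf) (component_two hg),
    inner_eq_integral (component_zero hf) (component_zero hg), form]
  simp only [evalAt_toFormSpace]
  ring

theorem formOperator_toFormSpace_eq_zero_iff {f : ℝ → ℂ} (hf : f ∈ formDomain) :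
    formOperator z b ν (toFormSpace hf) = 0 ↔
      ∀ g ∈ formDomain, form z b f g = ν * ∫ x, f x * conj (g x) := by
  refine ⟨fun h g hg => ?_, fun h => ext_inner_left ℂ fun w => ?_⟩
  · rw [← sub_eq_zero, ← inner_formOperator_toFormSpace hf hg, h, inner_zero_right]
  · obtain ⟨g, hg, rfl⟩ := exists_toFormSpace_eq w
    rw [inner_formOperator_toFormSpace, h g hg, sub_self, inner_zero_right]

theorem formOperator_injective (hb : 0 < b) (h0 : charFun z ν b ≠ 0) :
    Function.Injective (formOperator z b ν) := by
  refine (injective_iff_map_eq_zero _).2 fun v hv => eq_zero_of_component_zero_eq_zero ?_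
  obtain ⟨f, hf, rfl⟩ := exists_toFormSpace_eq v
  obtain rfl := eq_zero_of_forall_form_eq hb h0 hf
    ((formOperator_toFormSpace_eq_zero_iff hf).1 hv)
  exact Lp.eq_zero_iff_ae_eq_zero.2 (component_zero hf)

end FormOperator

/-! ### Coercivity on functions vanishing on a fine grid -/

theorem IsPrimitive.norm_sq_le_of_eq_zero {f g : ℝ → ℂ} (h : IsPrimitive f g) (hg : MemLp g 2)
    {p x δ : ℝ} (hp : f p = 0) (hx : |x - p| ≤ δ) : ‖f x‖ ^ 2 ≤ δ * ‖hg.toLp g‖ ^ 2 := by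
  have hsub := h.norm_sub_le hg p x
  rw [hp, sub_zero] at hsub
  calc ‖f x‖ ^ 2 ≤ (√|x - p| * ‖hg.toLp g‖) ^ 2 := by gcongr
    _ = |x - p| * ‖hg.toLp g‖ ^ 2 := by rw [mul_pow, Real.sq_sqrt (abs_nonneg _)]
    _ ≤ δ * ‖hg.toLp g‖ ^ 2 := by gcongr

theorem integral_norm_sq_le_of_forall_abs_le {f : ℝ → ℂ} (hf : MemLp f 2)
    (hxf : MemLp (fun x : ℝ => (x : ℂ) * f x) 2) {R C : ℝ} (hR : 0 < R) (hC : 0 ≤ C)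
    (hfC : ∀ x, |x| ≤ R → ‖f x‖ ^ 2 ≤ C) :
    ∫ x, ‖f x‖ ^ 2 ≤ 2 * R * C + (R ^ 2)⁻¹ * ∫ x : ℝ, ‖(x : ℂ) * f x‖ ^ 2 := by
  have hpt : ∀ x : ℝ, ‖f x‖ ^ 2 ≤ (Icc (-R) R).indicator (fun _ => C) x
      + (R ^ 2)⁻¹ * ‖(x : ℂ) * f x‖ ^ 2 := fun x => by
    rcases le_or_gt |x| R with hx | hx
    · rw [indicator_of_mem (show x ∈ Icc (-R) R from abs_le.1 hx)]
      exact (hfC x hx).trans (le_add_of_nonneg_right (by positivity))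
    · refine le_add_of_nonneg_of_le (indicator_nonneg (fun _ _ => hC) x) ?_
      rw [← div_eq_inv_mul, le_div_iff₀ (by positivity), norm_mul, mul_pow, mul_comm,
        Complex.norm_real, Real.norm_eq_abs]
      gcongr
  have hind : Integrable ((Icc (-R) R).indicator fun _ => C) :=
    (integrable_indicator_iff measurableSet_Icc).2 (integrableOn_const (by simp))
  have hmul : Integrable fun x : ℝ => (R ^ 2)⁻¹ * ‖(x : ℂ) * f x‖ ^ 2 :=
    hxf.norm.integrable_sq.const_mul _
  refine (integral_mono hf.norm.integrable_sq (hind.add hmul) hpt).trans_eq ?_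
  simp only [Pi.add_apply]
  rw [integral_add hind hmul, integral_const_mul, integral_indicator measurableSet_Icc,
    setIntegral_const, Real.volume_real_Icc_of_le (by linarith), smul_eq_mul]
  ring

theorem exists_finset_norm_sq_component_zero_le {ε : ℝ} (hε : 0 < ε) :
    ∃ S : Finset ℝ, ∀ v : formSpace, (∀ p ∈ S, evalAt p v = 0) →
      ‖component 0 v‖ ^ 2 ≤ ε * (‖component 1 v‖ ^ 2 + ‖component 2 v‖ ^ 2) := by
  obtain ⟨R, hR1, hRε⟩ : ∃ R : ℝ, 1 ≤ R ∧ ε⁻¹ ≤ R := ⟨_, le_max_left _ _, le_max_right _ _⟩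
  have hR : 0 < R := by linarith
  have hRε' : (R ^ 2)⁻¹ ≤ ε :=
    inv_le_of_inv_le₀ hε (hRε.trans (le_self_pow₀ hR1 two_ne_zero))
  obtain ⟨S, -, hS, hcover⟩ := finite_cover_balls_of_compact (isCompact_Icc (a := -R) (b := R))
    (show 0 < ε / (2 * R) by positivity)
  refine ⟨hS.toFinset, fun v hv => ?_⟩
  obtain ⟨f, hf, rfl⟩ := exists_toFormSpace_eq v
  have hlocal : ∀ x, |x| ≤ R → ‖f x‖ ^ 2 ≤ ε / (2 * R) * ‖component 1 (toFormSpace hf)‖ ^ 2 := by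
    intro x hx
    obtain ⟨p, hpS, hxp⟩ := mem_iUnion₂.1 (hcover (abs_le.1 hx))
    have hp : f p = 0 := by rw [← evalAt_toFormSpace p hf, hv p (hS.mem_toFinset.2 hpS)]
    exact (isPrimitive_weakDeriv hf).norm_sq_le_of_eq_zero (weakDeriv_spec hf.2.2.1).1 hp
      (Metric.mem_ball.1 hxp).le
  have hint := integral_norm_sq_le_of_forall_abs_le hf.2.1 hf.2.2.2 hR (by positivity) hlocal
  rw [← norm_sq_eq_integral (component_zero hf), ← norm_sq_eq_integral (component_two hf)] at hint
  calc ‖component 0 (toFormSpace hf)‖ ^ 2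
      ≤ 2 * R * (ε / (2 * R) * ‖component 1 (toFormSpace hf)‖ ^ 2)
        + (R ^ 2)⁻¹ * ‖component 2 (toFormSpace hf)‖ ^ 2 := hint
    _ = ε * ‖component 1 (toFormSpace hf)‖ ^ 2
        + (R ^ 2)⁻¹ * ‖component 2 (toFormSpace hf)‖ ^ 2 := by field_simp
    _ ≤ ε * (‖component 1 (toFormSpace hf)‖ ^ 2 + ‖component 2 (toFormSpace hf)‖ ^ 2) := by
      rw [mul_add]
      gcongr

section Spectrum

variable {z ν : ℂ} {b : ℝ}

theorem re_inner_formOperator_self {v : formSpace} (hb : evalAt b v = 0)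
    (hb' : evalAt (-b) v = 0) :
    (inner ℂ v (formOperator z b ν v)).re = ‖component 1 v‖ ^ 2 + 1 / 4 * ‖component 2 v‖ ^ 2
      - (1 / 2 + ν.re) * ‖component 0 v‖ ^ 2 := by
  have hself : ∀ w : L2, inner ℂ w w = ((‖w‖ ^ 2 : ℝ) : ℂ) := fun w => by
    rw [inner_self_eq_norm_sq_to_K, Complex.ofReal_pow]
    rfl
  have hquarter : (1 / 4 : ℂ) = ((1 / 4 : ℝ) : ℂ) := by norm_num
  have hhalf : (1 / 2 : ℂ) = ((1 / 2 : ℝ) : ℂ) := by norm_num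
  rw [inner_formOperator, hb, hb', hself, hself, hself, hquarter, hhalf, zero_mul, sub_self,
    mul_zero, add_zero, Complex.sub_re, Complex.add_re, Complex.ofReal_re, Complex.re_ofReal_mul,
    Complex.re_mul_ofReal, Complex.ofReal_re, Complex.add_re, Complex.ofReal_re]

theorem formOperator_bijective (hb : 0 < b) (h0 : charFun z ν b ≠ 0) :
    Function.Bijective (formOperator z b ν) := by
  have hinj := formOperator_injective hb h0
  obtain ⟨S, hS⟩ := exists_finset_norm_sq_component_zero_le
    (show 0 < 1 / (8 * (‖ν‖ + 1)) by positivity)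
  refine ⟨hinj, surjective_of_coercive_on_ker hinj
    (W := ((insert b (insert (-b) S) : Finset ℝ) → ℂ))
    (ContinuousLinearMap.pi fun p => evalAt p) (c := 1 / 8) (by norm_num) fun v hv => ?_⟩
  have heval : ∀ p ∈ insert b (insert (-b) S), evalAt p v = 0 := fun p hp => congrFun hv ⟨p, hp⟩
  have hsmall := hS v fun p hp => heval p (by simp [hp])
  rw [one_div_mul_eq_div, le_div_iff₀ (by positivity)] at hsmall
  rw [re_inner_formOperator_self (heval b (by simp)) (heval (-b) (by simp)), norm_sq_formSpace]
  have hν := mul_le_mul_of_nonneg_right (Complex.re_le_norm ν) (sq_nonneg ‖component 0 v‖)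
  linarith [sq_nonneg ‖component 1 v‖, sq_nonneg ‖component 0 v‖]

/-! ### Spectrum and eigenvalues -/

theorem exists_domain_iff_exists_form_eq {x y : L2} :
    (∃ t : (operator z b).domain, (t : L2) = x ∧ operator z b t = y) ↔
      ∃ f ∈ formDomain, x =ᵐ[volume] f ∧
        ∀ g ∈ formDomain, form z b f g = ∫ s, y s * conj (g s) := by
  have h : (x, y) ∈ (operator z b).graph ↔ (x, y) ∈ operatorGraph z b := by rw [operator_graph]
  rwa [LinearPMap.mem_graph_iff] at h

theorem exists_domain_iff_exists_formOperator_eq {x y : L2} (ν : ℂ) :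
    (∃ t : (operator z b).domain, (t : L2) = x ∧ operator z b t = y) ↔
      ∃ v : formSpace, component 0 v = x ∧
        formOperator z b ν v = ContinuousLinearMap.adjoint (component 0) (y - ν • x) := by
  have key : ∀ {f g : ℝ → ℂ} (hf : f ∈ formDomain) (hg : g ∈ formDomain), x =ᵐ[volume] f →
      (form z b f g = ∫ s, y s * conj (g s) ↔
        inner ℂ (toFormSpace hg) (formOperator z b ν (toFormSpace hf)) = inner ℂ (toFormSpace hg)
          (ContinuousLinearMap.adjoint (component 0) (y - ν • x))) := fun hf hg hx => by
    rw [inner_formOperator_toFormSpace, ContinuousLinearMap.adjoint_inner_right, inner_sub_right,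
      inner_smul_right, inner_eq_integral hx (component_zero hg),
      inner_eq_integral EventuallyEq.rfl (component_zero hg), sub_left_inj]
  rw [exists_domain_iff_exists_form_eq]
  constructor
  · rintro ⟨f, hf, hx, hform⟩
    refine ⟨toFormSpace hf, Lp.ext ((component_zero hf).trans hx.symm),
      ext_inner_left ℂ fun w => ?_⟩
    obtain ⟨g, hg, rfl⟩ := exists_toFormSpace_eq w
    exact (key hf hg hx).1 (hform g hg)
  · rintro ⟨v, hvx, hv⟩
    obtain ⟨f, hf, rfl⟩ := exists_toFormSpace_eq v
    have hx : x =ᵐ[volume] f := hvx ▸ component_zero hf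
    exact ⟨f, hf, hx, fun g hg => (key hf hg hx).2 (by rw [hv])⟩

theorem mem_resolventSet_of_charFun_ne_zero (hb : 0 < b) (h0 : charFun z ν b ≠ 0) :
    ν ∈ resolventSet (operator z b) := by
  have hbij := formOperator_bijective hb h0
  let e : formSpace ≃L[ℂ] formSpace := ContinuousLinearEquiv.ofBijective (formOperator z b ν)
    (LinearMap.ker_eq_bot.2 hbij.1) (LinearMap.range_eq_top.2 hbij.2)
  refine ⟨component 0 ∘L (e.symm : formSpace →L[ℂ] formSpace) ∘L
    ContinuousLinearMap.adjoint (component 0), fun h => ?_, fun t => ?_⟩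
  · set v := e.symm (ContinuousLinearMap.adjoint (component 0) h)
    obtain ⟨t, ht, hLt⟩ := (exists_domain_iff_exists_formOperator_eq (z := z) (b := b)
      (x := component 0 v) (y := h + ν • component 0 v) ν).2
      ⟨v, rfl, by rw [add_sub_cancel_right]; exact e.apply_symm_apply _⟩
    exact ⟨t, ht, by rw [hLt, ht, add_sub_cancel_right]⟩
  · obtain ⟨v, hvt, hv⟩ := (exists_domain_iff_exists_formOperator_eq ν).1 ⟨t, rfl, rfl⟩
    rw [ContinuousLinearMap.comp_apply, ContinuousLinearMap.comp_apply, ← hv, ← hvt]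
    exact congrArg (component 0) (e.symm_apply_apply v)

theorem isEigenvalue_of_charFun_eq_zero (hb : 0 < b) (h0 : charFun z ν b = 0) :
    IsEigenvalue (operator z b) ν := by
  obtain ⟨f, hf, hne, hform⟩ := exists_eigenfunction_of_charFun_eq_zero hb h0
  obtain ⟨t, ht, hLt⟩ := (exists_domain_iff_exists_formOperator_eq (z := z) (b := b)
    (x := component 0 (toFormSpace hf)) (y := ν • component 0 (toFormSpace hf)) ν).2
    ⟨_, rfl, by rw [sub_self, map_zero, formOperator_toFormSpace_eq_zero_iff]; exact hform⟩
  refine ⟨t, fun hzero => hne ?_, by rw [hLt, ht]⟩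
  rw [ht, Lp.eq_zero_iff_ae_eq_zero] at hzero
  exact (hf.1.ae_eq_iff_eq volume continuous_zero).1 ((component_zero hf).symm.trans hzero)

theorem IsEigenvalue.mem_spectrum {H : Type*} [NormedAddCommGroup H] [NormedSpace ℂ H]
    {T : H →ₗ.[ℂ] H} (h : IsEigenvalue T ν) : ν ∈ spectrum T := by
  rintro ⟨R, -, hR⟩
  obtain ⟨x, hx, hTx⟩ := h
  have hRx := hR x
  rw [hTx, sub_self, map_zero] at hRx
  exact hx hRx.symm

theorem spectrum_and_eigenvalue_iff (hb : 0 < b) (z ν : ℂ) :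
    (ν ∈ spectrum (operator z b) ↔ charFun z ν b = 0) ∧
      (IsEigenvalue (operator z b) ν ↔ charFun z ν b = 0) := by
  have hspec : ν ∈ spectrum (operator z b) → charFun z ν b = 0 := fun h =>
    by_contra fun h0 => h (mem_resolventSet_of_charFun_ne_zero hb h0)
  have heig : charFun z ν b = 0 → IsEigenvalue (operator z b) ν :=
    isEigenvalue_of_charFun_eq_zero hb
  exact ⟨⟨hspec, fun h => (heig h).mem_spectrum⟩, ⟨fun h => hspec h.mem_spectrum, heig⟩⟩

end Spectrum

/-! ### The function `M` -/

theorem Gamma_neg_ne_zero {ν : ℂ} (hν : ∀ n : ℕ, ν ≠ n) : Complex.Gamma (-ν) ≠ 0 :=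
  Complex.Gamma_ne_zero fun n h => hν n (neg_injective h)

theorem Gamma_mul_charFun {ν : ℂ} (hν : ∀ n : ℕ, ν ≠ n) (z : ℂ) (b : ℝ) :
    Complex.Gamma (-ν) * charFun z ν b = 1 - z ^ 2 * M ν b := by
  rw [charFun, mul_sub, mul_inv_cancel₀ (Gamma_neg_ne_zero hν), M]
  ring

theorem charFun_eq_zero_iff {ν : ℂ} (hν : ∀ n : ℕ, ν ≠ n) (z : ℂ) (b : ℝ) :
    charFun z ν b = 0 ↔ z ≠ 0 ∧ M ν b = 1 / z ^ 2 := by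
  rw [← mul_right_inj' (Gamma_neg_ne_zero hν), mul_zero, Gamma_mul_charFun hν, sub_eq_zero]
  rcases eq_or_ne z 0 with rfl | hz
  · simp
  · rw [and_iff_right hz, eq_div_iff (pow_ne_zero 2 hz), mul_comm, eq_comm]

theorem differentiable_evenWeight : Differentiable ℂ evenWeight := by
  have hpow : Differentiable ℂ fun ν : ℂ => (2 : ℂ) ^ (ν / 2) := fun ν =>
    (differentiableAt_id.div_const 2).const_cpow (Or.inl two_ne_zero)
  have hGamma : Differentiable ℂ fun ν : ℂ => (Complex.Gamma (-ν / 2 + 1 / 2))⁻¹ :=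
    Complex.differentiable_one_div_Gamma.comp (by fun_prop)
  exact (hpow.mul_const _).mul hGamma

theorem differentiable_oddWeight : Differentiable ℂ oddWeight := by
  rw [funext oddWeight_eq_neg_mul_evenWeight]
  exact differentiable_id.neg.mul (differentiable_evenWeight.comp (differentiable_id.sub_const 1))

theorem differentiable_parabolicD_left (x : ℂ) : Differentiable ℂ fun ν => parabolicD ν x :=
  (differentiable_evenWeight.mul (differentiable_yEven_left x)).sub
    (differentiable_oddWeight.mul (differentiable_yOdd_left x))

/-- The entire cofactor of `Γ(-ν)` in `M`. -/
def regularFactor (b : ℝ) (ν : ℂ) : ℂ :=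
  (√(2 / Real.pi) : ℂ) * parabolicD ν b ^ 2 * yEven ν b * yOdd ν b

theorem M_eq (ν : ℂ) (b : ℝ) : M ν b = Complex.Gamma (-ν) * regularFactor b ν := by
  rw [M, regularFactor]
  ring

theorem differentiable_regularFactor (b : ℝ) : Differentiable ℂ (regularFactor b) :=
  ((((differentiable_parabolicD_left b).pow 2).const_mul _).mul (differentiable_yEven_left b)).mul
    (differentiable_yOdd_left b)

theorem yEven_zero_left (x : ℂ) : yEven 0 x = Complex.exp (-x ^ 2 / 4) := by
  rw [yEven_eq, cylSeries_zero_shift, zero_mul, sub_zero, mul_one]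

theorem yOdd_zero_left_ne_zero {b : ℝ} (hb : 0 < b) : yOdd 0 b ≠ 0 := by
  rw [yOdd_eq]
  refine mul_ne_zero (Complex.exp_ne_zero _) ?_
  let r : ℕ → ℝ := fun k =>
    (∏ j ∈ Finset.range k, (1 + 2 * (j : ℝ))) * (b ^ (2 * k + 1) / ((2 * k + 1).factorial : ℝ))
  have hr : ∀ k, cylCoeff (0 - 1) k * divPow (2 * k + 1) b = (r k : ℂ) := fun k => by
    simp [r, cylCoeff, divPow]
  have hpos : ∀ k, 0 < r k := fun k =>
    mul_pos (Finset.prod_pos fun j _ => by positivity) (by positivity)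
  have hsum : Summable r := by
    simpa only [hr, Complex.summable_ofReal] using summable_cylSeries (0 - 1) 1 b
  simp only [cylSeries, hr]
  rw [← Complex.ofReal_tsum, Complex.ofReal_ne_zero]
  exact (hsum.tsum_pos (fun k => (hpos k).le) 0 (hpos 0)).ne'

theorem parabolicD_zero_left_ne_zero (x : ℂ) : parabolicD 0 x ≠ 0 := by
  have hodd : oddWeight 0 = 0 := by rw [oddWeight_eq_neg_mul_evenWeight, neg_zero, zero_mul]
  have heven : evenWeight 0 ≠ 0 :=
    (evenWeight_ne_zero_or_oddWeight_ne_zero 0).resolve_right fun h => h hodd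
  rw [parabolicD_eq, hodd, zero_mul, sub_zero, yEven_zero_left]
  exact mul_ne_zero heven (Complex.exp_ne_zero _)

theorem regularFactor_zero_ne_zero {b : ℝ} (hb : 0 < b) : regularFactor b 0 ≠ 0 := by
  have hsqrt : ((√(2 / Real.pi) : ℝ) : ℂ) ≠ 0 :=
    Complex.ofReal_ne_zero.2 (Real.sqrt_pos.2 (by positivity)).ne'
  have heven : yEven 0 b ≠ 0 := yEven_zero_left b ▸ Complex.exp_ne_zero _
  exact mul_ne_zero (mul_ne_zero (mul_ne_zero hsqrt
    (pow_ne_zero 2 (parabolicD_zero_left_ne_zero b))) heven) (yOdd_zero_left_ne_zero hb)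

theorem meromorphicAt_M (b : ℝ) : MeromorphicAt (fun ν : ℂ => M ν b) 0 := by
  simp only [M_eq]
  exact ((Meromorphic.Gamma (-0)).comp_analyticAt analyticAt_id.neg).mul
    ((differentiable_regularFactor b).analyticAt 0).meromorphicAt

theorem tendsto_mul_M (b : ℝ) :
    Tendsto (fun ν : ℂ => ν * M ν b) (𝓝[≠] 0) (𝓝 (-regularFactor b 0)) := by
  have hneg : Tendsto (fun ν : ℂ => -ν) (𝓝[≠] 0) (𝓝[≠] 0) :=
    tendsto_nhdsWithin_of_tendsto_nhds_of_eventually_within _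
      (by simpa using (continuous_neg.tendsto (0 : ℂ)).mono_left nhdsWithin_le_nhds)
      (eventually_mem_nhdsWithin.mono fun ν hν => neg_ne_zero.2 hν)
  have hfactor : Tendsto (regularFactor b) (𝓝[≠] 0) (𝓝 (regularFactor b 0)) :=
    (differentiable_regularFactor b).continuous.continuousAt.tendsto.mono_left nhdsWithin_le_nhds
  have h := ((Complex.tendsto_self_mul_Gamma_nhds_zero.comp hneg).mul hfactor).neg
  rw [one_mul] at h
  refine h.congr fun ν => ?_
  rw [Function.comp_apply, M_eq]
  ring

theorem meromorphicOrderAt_M {b : ℝ} (hb : 0 < b) :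
    meromorphicOrderAt (fun ν : ℂ => M ν b) 0 = (-1 : ℤ) := by
  have hid : MeromorphicAt (id : ℂ → ℂ) 0 := MeromorphicAt.id 0
  have hmul := (tendsto_ne_zero_iff_meromorphicOrderAt_eq_zero (hid.mul (meromorphicAt_M b))).1
    ⟨_, neg_ne_zero.2 (regularFactor_zero_ne_zero hb), tendsto_mul_M b⟩
  rw [meromorphicOrderAt_mul hid (meromorphicAt_M b), meromorphicOrderAt_id] at hmul
  generalize meromorphicOrderAt (fun ν : ℂ => M ν b) 0 = n at hmul ⊢
  induction n with
  | top => exact absurd hmul (by simp)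
  | coe n =>
    have hn : 1 + n = 0 := by exact_mod_cast hmul
    rw [eq_neg_of_add_eq_zero_right hn]

theorem eventually_ne_natCast : ∀ᶠ ν : ℂ in 𝓝[≠] 0, ∀ n : ℕ, ν ≠ n := by
  filter_upwards [self_mem_nhdsWithin, nhdsWithin_le_nhds (Metric.ball_mem_nhds (0 : ℂ) one_pos)]
    with ν hne hball n hn
  rw [hn, mem_ball_zero_iff, Complex.norm_natCast, Nat.cast_lt_one] at hball
  exact hne (by rw [hn, hball, Nat.cast_zero]; rfl)

theorem M_not_constant {b : ℝ} (hb : 0 < b) :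
    ¬ ∃ c : ℂ, ∀ ν : ℂ, (∀ n : ℕ, ν ≠ n) → M ν b = c := by
  rintro ⟨c, hc⟩
  have hM : (fun ν : ℂ => M ν b) =ᶠ[𝓝[≠] 0] fun _ => c :=
    eventually_ne_natCast.mono hc
  have hnonneg := (analyticAt_const (x := (0 : ℂ)) (v := c)).meromorphicOrderAt_nonneg
  rw [← meromorphicOrderAt_congr hM, meromorphicOrderAt_M hb] at hnonneg
  exact absurd hnonneg (by decide)

theorem conj_M (ν : ℂ) (b : ℝ) : conj (M ν b) = M (conj ν) b := by
  simp only [M, map_mul, map_pow, conj_parabolicD, conj_yEven, conj_yOdd, ← Complex.Gamma_conj,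
    map_neg, Complex.conj_ofReal]

theorem exists_M_eq_ofReal (ν b : ℝ) : ∃ r : ℝ, M (ν : ℂ) b = (r : ℂ) :=
  Complex.conj_eq_iff_real.1 (by rw [conj_M, Complex.conj_ofReal])

end PointInteraction

end

theorem mainTheorem3 (b : ℝ) (hb : 0 < b) :
    -- the eigenvalue condition for arbitrary `ν`
    (∀ z ν : ℂ,
      (ν ∈ PointInteraction.spectrum (PointInteraction.operator z b) ↔
        (Complex.Gamma (-ν))⁻¹ - z ^ 2 * PointInteraction.parabolicD ν b ^ 2 *
          ((√(2 / Real.pi) : ℂ) * PointInteraction.yEven ν b * PointInteraction.yOdd ν b) = 0) ∧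
      (PointInteraction.IsEigenvalue (PointInteraction.operator z b) ν ↔
        (Complex.Gamma (-ν))⁻¹ - z ^ 2 * PointInteraction.parabolicD ν b ^ 2 *
          ((√(2 / Real.pi) : ℂ) * PointInteraction.yEven ν b * PointInteraction.yOdd ν b) = 0)) ∧
    -- the eigenvalue condition for `ν ∉ ℕ₀`; for `z = 0` the equation `M = 1 / z ^ 2` is void
    (∀ z ν : ℂ, (∀ n : ℕ, ν ≠ n) →
      (ν ∈ PointInteraction.spectrum (PointInteraction.operator z b) ↔
        z ≠ 0 ∧ PointInteraction.M ν b = 1 / z ^ 2) ∧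
      (PointInteraction.IsEigenvalue (PointInteraction.operator z b) ν ↔
        z ≠ 0 ∧ PointInteraction.M ν b = 1 / z ^ 2)) ∧
    -- the pole at `ν = 0` is not removable
    meromorphicOrderAt (fun ν : ℂ => PointInteraction.M ν b) 0 < 0 ∧
    -- `M` is not constant in `ν`
    (¬ ∃ c : ℂ, ∀ ν : ℂ, (∀ n : ℕ, ν ≠ n) → PointInteraction.M ν b = c) ∧
    -- `M` is real for real `ν`
    (∀ ν : ℝ, (∀ n : ℕ, ν ≠ n) → ∃ r : ℝ, PointInteraction.M (ν : ℂ) b = (r : ℂ)) := by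
  refine ⟨fun z ν => PointInteraction.spectrum_and_eigenvalue_iff hb z ν, fun z ν hν => ?_,
    (PointInteraction.meromorphicOrderAt_M hb).trans_lt (by decide),
    PointInteraction.M_not_constant hb, fun ν _ => PointInteraction.exists_M_eq_ofReal ν b⟩
  have h := PointInteraction.spectrum_and_eigenvalue_iff hb z ν
  rwa [PointInteraction.charFun_eq_zero_iff hν] at h
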